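/- **Conventions.** A geodesic metric space is *hyperbolic* if there is $\delta\ge 0$ such that every side of every geodesic triangle is contained in the closed $\delta$-neighbourhood of the union of the other two sides. Given a group $G$ and a generating set $S$, the *Cayley graph* of $G$ with respect to $S$ is the oriented graph with vertex set $G$ and edge set $G\times S$, where the edge $(g,s)$ goes from $g$ to $gs$; it is regarded as a metric space (a 1-complex with the path metric) in which every edge has length $1$. For a collection $\mathcal H=\{H_1,\dots,H_m\}$ of subgroups of $G$, a subset $X\subseteq G$ is a *relative generating set* of $G$ with respect to $\mathcal H$ if $X\cup H_1\cup\dots\cup H_m$ generates $G$. The group $G$ is *weakly hyperbolic relative to* $\mathcal H$ if there is a finite relative generating set $X$ of $G$ with respect to $\mathcal H$ such that the Cayley graph of $G$ with respect to $X\cup H_1\cup\dots\cup H_m$ is hyperbolic. "Relative to $K$", for a single subgroup $K$, means relative to $\{K\}$. **Theorem.** Let $H$ be an arbitrary group, let $A$ and $B$ be subgroups of $H$, and let $\varphi\colon A\to B$ be an isomorphism. Let $$G=\langle H,\,t \mid t\,a\,t^{-1}=\varphi(a),\ a\in A\rangle$$ be the HNN-extension of $H$ with associated subgroups $A$ and $B$,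 and regard $H$ (and hence $A$) as a subgroup of $G$. 1. $G$ is weakly hyperbolic relative to $H$. 2. If $H$ is weakly hyperbolic relative to $\{A,B\}$, then $G$ is weakly hyperbolic relative to $A$. -/

import Mathlib

noncomputable section

universe u v

/-! ## Hyperbolic metric spaces -/

section Hyperbolic

variable {M : Type u} [MetricSpace M]

/-- `σ` is (the image of) a geodesic from `x` to `y`. -/
def IsGeodesicSegment (x y : M) (σ : Set M) : Prop :=
  ∃ (ℓ : ℝ) (γ : ℝ → M), 0 ≤ ℓ ∧ γ 0 = x ∧ γ ℓ = y ∧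
    (∀ s ∈ Set.Icc 0 ℓ, ∀ t ∈ Set.Icc 0 ℓ, dist (γ s) (γ t) = |s - t|) ∧
    σ = γ '' Set.Icc 0 ℓ

variable (M) in
/-- Any two points are joined by a geodesic. -/
def IsGeodesicSpace : Prop :=
  ∀ x y : M, ∃ σ : Set M, IsGeodesicSegment x y σ

variable (M) in
/-- A geodesic metric space is hyperbolic if, for some `δ ≥ 0`, every side of every geodesic
triangle lies in the closed `δ`-neighbourhood of the union of the other two sides. Geodesic
segments can be reversed, so it is enough to speak of the side `σ₁` of each triangle. -/
def IsHyperbolicSpace : Prop :=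
  IsGeodesicSpace M ∧
    ∃ δ : ℝ, 0 ≤ δ ∧ ∀ (x y z : M) (σ₁ σ₂ σ₃ : Set M),
      IsGeodesicSegment x y σ₁ → IsGeodesicSegment y z σ₂ → IsGeodesicSegment z x σ₃ →
        ∀ p ∈ σ₁, ∃ q ∈ σ₂ ∪ σ₃, dist p q ≤ δ

end Hyperbolic

/-! ## Graphs as metric 1-complexes -/

/-- An oriented graph; loops and multiple edges are allowed. -/
structure OrientedGraph (V : Type u) (E : Type v) where
  /-- origin of an edge -/
  src : E → V
  /-- terminus of an edge -/
  tgt : E → V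

namespace OrientedGraph

variable {V : Type u} {E : Type v} (Γ : OrientedGraph V E)

/-- The simple graph on the vertices joining distinct ends of edges (in either direction). -/
def skeleton : SimpleGraph V :=
  SimpleGraph.fromRel fun x y => ∃ e : E, Γ.src e = x ∧ Γ.tgt e = y

/-- Points of the 1-complex before gluing: vertices, and the point at distance `r ∈ [0, 1]` from
the origin on the edge `e`. -/
inductive Point (Γ : OrientedGraph V E) : Type (max u v)
  | vertex (x : V) : Point Γ
  | onEdge (e : E) (r : Set.Icc (0 : ℝ) 1) : Point Γ

variable {Γ}

/-- The vertices at the two ends of the edge carrying a point (the vertex itself for a vertex). -/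
def Point.foot : Γ.Point → Bool → V
  | vertex x, _ => x
  | onEdge e _, false => Γ.src e
  | onEdge e _, true => Γ.tgt e

/-- The length, along the edge carrying a point, from the point to each of its feet. -/
def Point.gap : Γ.Point → Bool → ℝ
  | vertex _, _ => 0
  | onEdge _ r, false => r
  | onEdge _ r, true => 1 - r

/-- `Route p q ℓ`: the complex, all of whose edges have length 1, contains a path of length `ℓ`
from `p` to `q` that either stays inside one edge, or leaves `p` through one of its feet, follows
a shortest edge path, and enters `q` through one of its feet. -/
inductive Route : Γ.Point → Γ.Point → ℝ → Prop
  | along (e : E) (r s : Set.Icc (0 : ℝ) 1) :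
      Route (.onEdge e r) (.onEdge e s) |(r : ℝ) - s|
  | through (p q : Γ.Point) (i j : Bool) :
      Route p q (p.gap i + Γ.skeleton.dist (p.foot i) (q.foot j) + q.gap j)

lemma Point.gap_nonneg (p : Γ.Point) (i : Bool) : 0 ≤ p.gap i := by
  rcases p with x | ⟨e, r, h0, h1⟩ <;> cases i <;> simp [Point.gap, *]

lemma Route.nonneg {p q : Γ.Point} {ℓ : ℝ} (h : Route p q ℓ) : 0 ≤ ℓ := by
  cases h with
  | along e r s => exact abs_nonneg _
  | through _ _ i j =>
    have := p.gap_nonneg i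
    have := q.gap_nonneg j
    positivity

lemma Route.refl (p : Γ.Point) : Route p p 0 := by
  rcases p with x | ⟨e, r⟩
  · simpa [Point.gap, Point.foot] using Route.through (Γ := Γ) (.vertex x) (.vertex x) true true
  · simpa using Route.along (Γ := Γ) e r r

lemma Route.symm {p q : Γ.Point} {ℓ : ℝ} (h : Route p q ℓ) : Route q p ℓ := by
  cases h with
  | along e r s => rw [abs_sub_comm]; exact .along e s r
  | through _ _ i j =>
    have := Route.through q p j i
    rw [SimpleGraph.dist_comm] at this
    convert this using 1
    ring

lemma dist_src_tgt_le (Γ : OrientedGraph V E) (e : E) :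
    Γ.skeleton.dist (Γ.src e) (Γ.tgt e) ≤ 1 := by
  by_cases h : Γ.src e = Γ.tgt e
  · simp [h]
  · have : Γ.skeleton.Adj (Γ.src e) (Γ.tgt e) := by
      simp only [skeleton, SimpleGraph.fromRel_adj]
      exact ⟨h, .inl ⟨e, rfl, rfl⟩⟩
    exact (SimpleGraph.dist_eq_one_iff_adj.2 this).le

/-- The two feet of a point are no further apart than the path through the point. -/
lemma Point.dist_foot_le (p : Γ.Point) (i j : Bool) :
    (Γ.skeleton.dist (p.foot i) (p.foot j) : ℝ) ≤ p.gap i + p.gap j := by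
  rcases p with x | ⟨e, r, h0, h1⟩
  · simp [Point.foot, Point.gap]
  · have h : (Γ.skeleton.dist (Γ.src e) (Γ.tgt e) : ℝ) ≤ 1 := by
      exact_mod_cast dist_src_tgt_le Γ e
    have h' : (Γ.skeleton.dist (Γ.tgt e) (Γ.src e) : ℝ) ≤ 1 := by
      rwa [SimpleGraph.dist_comm]
    cases i <;> cases j <;> simp only [Point.foot, Point.gap, SimpleGraph.dist_self,
      Nat.cast_zero] <;> linarith

lemma foot_same_edge (e : E) (r s : Set.Icc (0 : ℝ) 1) (i : Bool) :
    Point.foot (Γ := Γ) (.onEdge e r) i = Point.foot (Γ := Γ) (.onEdge e s) i := by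
  cases i <;> rfl

lemma gap_le_of_same_edge (e : E) (r s : Set.Icc (0 : ℝ) 1) (i : Bool) :
    Point.gap (Γ := Γ) (.onEdge e r) i ≤ |(r : ℝ) - s| + Point.gap (Γ := Γ) (.onEdge e s) i := by
  cases i <;> simp only [Point.gap]
  · linarith [le_abs_self ((r : ℝ) - s)]
  · linarith [neg_abs_le ((r : ℝ) - s)]

lemma Route.trans (hΓ : Γ.skeleton.Connected) {p q w : Γ.Point} {k ℓ : ℝ}
    (h₁ : Route p q k) (h₂ : Route q w ℓ) : ∃ m ≤ k + ℓ, Route p w m := by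
  cases h₁ with
  | along e r s =>
    cases h₂ with
    | along _ _ t => exact ⟨_, abs_sub_le _ _ _, .along e r t⟩
    | through _ _ i j =>
      refine ⟨_, ?_, .through _ _ i j⟩
      have := gap_le_of_same_edge (Γ := Γ) e r s i
      rw [foot_same_edge e r s]
      linarith
  | through _ _ i j =>
    cases h₂ with
    | along e s t =>
      refine ⟨_, ?_, .through _ _ i j⟩
      have := gap_le_of_same_edge (Γ := Γ) e t s j
      rw [abs_sub_comm] at this
      rw [foot_same_edge e t s]
      linarith
    | through _ _ i' j' =>
      refine ⟨_, ?_, .through _ _ i j'⟩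
      have h1 : (Γ.skeleton.dist (p.foot i) (w.foot j') : ℝ) ≤
          Γ.skeleton.dist (p.foot i) (q.foot j) + Γ.skeleton.dist (q.foot j) (w.foot j') := by
        exact_mod_cast hΓ.dist_triangle
      have h2 : (Γ.skeleton.dist (q.foot j) (w.foot j') : ℝ) ≤
          Γ.skeleton.dist (q.foot j) (q.foot i') + Γ.skeleton.dist (q.foot i') (w.foot j') := by
        exact_mod_cast hΓ.dist_triangle
      linarith [q.dist_foot_le j i']

/-- The length of a shortest path between two points of the complex. -/
def pointDist (p q : Γ.Point) : ℝ := sInf {ℓ | Route p q ℓ}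

lemma pointDist_le {p q : Γ.Point} {ℓ : ℝ} (h : Route p q ℓ) : pointDist p q ≤ ℓ :=
  csInf_le ⟨0, fun _ h => h.nonneg⟩ h

lemma le_pointDist {p q : Γ.Point} {c : ℝ} (h : ∀ ℓ, Route p q ℓ → c ≤ ℓ) :
    c ≤ pointDist p q :=
  le_csInf ⟨_, .through p q true true⟩ h

lemma pointDist_triangle (hΓ : Γ.skeleton.Connected) (p q w : Γ.Point) :
    pointDist p w ≤ pointDist p q + pointDist q w := by
  rw [← sub_le_iff_le_add]
  refine le_pointDist fun k hk => ?_
  rw [sub_le_comm]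
  refine le_pointDist fun ℓ hℓ => ?_
  obtain ⟨m, hm, h⟩ := hk.trans hΓ hℓ
  linarith [pointDist_le h]

/-- The points of a connected graph, equipped with the combinatorial (pseudo)metric. -/
def PreRealization (_hΓ : Γ.skeleton.Connected) : Type (max u v) := Γ.Point

instance (hΓ : Γ.skeleton.Connected) : PseudoMetricSpace (PreRealization hΓ) where
  dist p q := pointDist (Γ := Γ) p q
  dist_self p := le_antisymm (pointDist_le (.refl p)) (le_pointDist fun _ h => h.nonneg)
  dist_comm p q := le_antisymm (le_pointDist fun _ h => pointDist_le h.symm)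
    (le_pointDist fun _ h => pointDist_le h.symm)
  dist_triangle := pointDist_triangle hΓ

/-- A connected graph as a metric 1-complex: all edges have length 1, and points at distance 0 (the
ends of an edge and the corresponding vertices) are glued together. -/
abbrev Realization (hΓ : Γ.skeleton.Connected) : Type (max u v) :=
  SeparationQuotient (PreRealization hΓ)

/-- The point of the metric 1-complex given by `p`. -/
def toRealization (hΓ : Γ.skeleton.Connected) (p : Γ.Point) : Realization hΓ :=
  SeparationQuotient.mk (X := PreRealization hΓ) p

lemma toRealization_surjective (hΓ : Γ.skeleton.Connected) :
    Function.Surjective (toRealization hΓ) :=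
  SeparationQuotient.surjective_mk (X := PreRealization hΓ)

lemma dist_toRealization (hΓ : Γ.skeleton.Connected) (p q : Γ.Point) :
    dist (toRealization hΓ p) (toRealization hΓ q) = pointDist p q :=
  rfl

lemma dist_toRealization_vertex (hΓ : Γ.skeleton.Connected) (x y : V) :
    dist (toRealization hΓ (.vertex x)) (toRealization hΓ (.vertex y)) = Γ.skeleton.dist x y := by
  rw [dist_toRealization]
  refine le_antisymm (pointDist_le ?_) (le_pointDist fun ℓ hℓ => ?_)
  · simpa [Point.gap, Point.foot] using
      Route.through (Γ := Γ) (.vertex x) (.vertex y) true true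
  · cases hℓ
    simp [Point.gap, Point.foot]

end OrientedGraph

/-! ## Cayley graphs and weak relative hyperbolicity -/

section Groups

variable {G : Type u} [Group G]

/-- The Cayley graph of `G` with respect to `S`: vertex set `G`, edge set `G × S`, and the edge
`(g, s)` goes from `g` to `gs`. -/
def cayleyGraph (S : Set G) : OrientedGraph G (G × S) where
  src e := e.1
  tgt e := e.1 * e.2

lemma cayleyGraph_skeleton (S : Set G) :
    (cayleyGraph S).skeleton = SimpleGraph.mulCayley S := by
  ext x y
  simp only [OrientedGraph.skeleton, cayleyGraph, SimpleGraph.fromRel_adj,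
    SimpleGraph.mulCayley_adj']
  refine and_congr_right fun _ => ⟨?_, ?_⟩
  · rintro (⟨⟨g, s⟩, rfl, rfl⟩ | ⟨⟨g, s⟩, rfl, rfl⟩)
    exacts [⟨s, s.2, .inl rfl⟩, ⟨s, s.2, .inr rfl⟩]
  · rintro ⟨s, hs, rfl | rfl⟩
    exacts [.inl ⟨(x, ⟨s, hs⟩), rfl, rfl⟩, .inr ⟨(y, ⟨s, hs⟩), rfl, rfl⟩]

lemma cayleyGraph_connected {S : Set G} (hS : Subgroup.closure S = ⊤) :
    (cayleyGraph S).skeleton.Connected := by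
  rw [cayleyGraph_skeleton]
  have step : ∀ (x s : G), s ∈ S → (SimpleGraph.mulCayley S).Reachable x (x * s) := by
    intro x s hs
    by_cases h : x = x * s
    · rw [← h]
    · exact SimpleGraph.Adj.reachable
        ((SimpleGraph.mulCayley_adj' _ _ _).2 ⟨h, s, hs, .inl rfl⟩)
  have key : ∀ g ∈ Subgroup.closure S, ∀ x, (SimpleGraph.mulCayley S).Reachable x (x * g) := by
    intro g hg
    induction hg using Subgroup.closure_induction with
    | mem s hs => exact fun x => step x s hs
    | one => intro x; rw [mul_one]
    | mul a b _ _ ha hb => intro x; rw [← mul_assoc]; exact (ha x).trans (hb _)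
    | inv a _ ha => intro x; simpa using (ha (x * a⁻¹)).symm
  have : Nonempty G := ⟨1⟩
  refine ⟨fun x y => ?_⟩
  simpa using key (x⁻¹ * y) (hS ▸ Subgroup.mem_top _) x

/-- The set `X ∪ ⋃ K ∈ 𝓗, K`. -/
def relativeAlphabet (𝓗 : Set (Subgroup G)) (X : Set G) : Set G :=
  X ∪ ⋃ K ∈ 𝓗, (K : Set G)

/-- `X` is a relative generating set of `G` with respect to the collection `𝓗` of subgroups. -/
def IsRelativeGeneratingSet (𝓗 : Set (Subgroup G)) (X : Set G) : Prop :=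
  Subgroup.closure (relativeAlphabet 𝓗 X) = ⊤

/-- The relative Cayley graph of `G` with respect to `𝓗`, as a metric space: the Cayley graph with
respect to the generating set `X ∪ ⋃ K ∈ 𝓗, K`. -/
abbrev RelativeCayleyGraph {𝓗 : Set (Subgroup G)} {X : Set G}
    (hX : IsRelativeGeneratingSet 𝓗 X) : Type u :=
  OrientedGraph.Realization (cayleyGraph_connected hX)

/-- `G` is weakly hyperbolic relative to the collection `𝓗` of subgroups. -/
def IsWeaklyHyperbolicRelativeTo (𝓗 : Set (Subgroup G)) : Prop :=
  ∃ (X : Set G) (hX : IsRelativeGeneratingSet 𝓗 X),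
    X.Finite ∧ IsHyperbolicSpace (RelativeCayleyGraph hX)

end Groups

end

/-!
Each vertex of the Bass–Serre tree of the HNN extension `G` is a left coset `zH` of the base group,
which carries a copy of a Cayley graph of `H`, and each edge joins two such copies along cosets of
`A` and `B`. If the generating set `Y` of `H` contains `A` and `B`, these cosets have diameter `1`,
so `G` looks like a tree of hyperbolic spaces glued along bounded sets, and such a space is
hyperbolic. For the first claim `Y = H`, and the copies themselves are bounded; for the second `Y`
is the finite relative generating set together with `A` and `B`. In the second case the generating
set of `G` does not contain `B`, but as `B = t A t⁻¹` its elements have length at most `3`.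

Hyperbolicity is proved by guessing geodesics (`IsGuess.isHyperbolicSpace`): it suffices to have
coarsely connected sets joining pairs of points that form uniformly thin triangles. This criterion
is insensitive to bi-Lipschitz changes of the metric, which takes care of the word length of `B`.
The guess (`HNNExtension.guess`) joining `x` to `y` runs through the cosets `zH` separating them,
following in each a geodesic from the points where `zH` is entered from `x` to those where it is
entered from `y`. Triangles are thin (`HNNExtension.guess_thin`) since at a coset `zH` the third
vertex either lies beyond the same edge as `x` or `y`, when there is nothing to do, or gives a
geodesic triangle in the copy of the Cayley graph of `H` at `zH`.

The only input on HNN extensions is that their normal forms are unique. It gives that a branch at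
`zH`, a component of the complement of `zH`, is entered through a single coset of `A` or `B`
(`HNNExtension.SameBranch.entry_coset`), and that each edge of the tree separates
(`HNNExtension.SameBranch.separation`).
-/

noncomputable section

universe u v

/-! ### Geodesics and the guessing-geodesics criterion -/

/-- `γ` restricted to `[a, b]` is an isometric embedding. -/
def IsometricOn {M : Type u} [MetricSpace M] (γ : ℝ → M) (a b : ℝ) : Prop :=
  ∀ s ∈ Set.Icc a b, ∀ t ∈ Set.Icc a b, dist (γ s) (γ t) = |s - t|

section Criterion

variable {M : Type u} [MetricSpace M]

lemma IsometricOn.mono {γ : ℝ → M} {a b a' b' : ℝ} (h : IsometricOn γ a b) (ha : a ≤ a')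
    (hb : b' ≤ b) : IsometricOn γ a' b' :=
  fun s hs t ht => h s ⟨ha.trans hs.1, hs.2.trans hb⟩ t ⟨ha.trans ht.1, ht.2.trans hb⟩

lemma IsGeodesicSegment.reverse {x y : M} {σ : Set M} (h : IsGeodesicSegment x y σ) :
    IsGeodesicSegment y x σ := by
  obtain ⟨ℓ, γ, hℓ, rfl, rfl, hγ, rfl⟩ := h
  refine ⟨ℓ, fun s => γ (ℓ - s), hℓ, by simp, by simp, fun s hs t ht => ?_, ?_⟩
  · rw [hγ _ ⟨by linarith [hs.2], by linarith [hs.1]⟩ _ ⟨by linarith [ht.2], by linarith [ht.1]⟩,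
      abs_sub_comm]
    congr 1
    ring
  · ext p
    constructor
    · rintro ⟨s, hs, rfl⟩
      exact ⟨ℓ - s, ⟨by linarith [hs.2], by linarith [hs.1]⟩, by simp⟩
    · rintro ⟨s, hs, rfl⟩
      exact ⟨ℓ - s, ⟨by linarith [hs.2], by linarith [hs.1]⟩, by simp⟩

lemma IsGeodesicSegment.dist_add_dist {x y p : M} {σ : Set M} (h : IsGeodesicSegment x y σ)
    (hp : p ∈ σ) : dist x p + dist p y = dist x y := by
  obtain ⟨ℓ, γ, hℓ, rfl, rfl, hγ, rfl⟩ := h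
  obtain ⟨s, hs, rfl⟩ := hp
  rw [hγ 0 ⟨le_rfl, hℓ⟩ s hs, hγ s hs ℓ ⟨hℓ, le_rfl⟩, hγ 0 ⟨le_rfl, hℓ⟩ ℓ ⟨hℓ, le_rfl⟩,
    abs_of_nonpos (by linarith [hs.1]), abs_of_nonpos (by linarith [hs.2]),
    abs_of_nonpos (by linarith)]
  ring

/-- A family of guessed geodesics: sets `L x y`, small for close `x` and `y`, coarsely connected,
and forming `h`-thin triangles. Coarse connectedness is phrased through cuts: whenever `P` contains
`x` but not `y`, some two points of `L x y` at distance at most `h` are separated by `P`. -/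
structure IsGuess (L : M → M → Set M) (h : ℝ) : Prop where
  left_mem : ∀ x y, x ∈ L x y
  right_mem : ∀ x y, y ∈ L x y
  small : ∀ x y, dist x y ≤ 1 → ∀ z ∈ L x y, dist z x ≤ h
  thin : ∀ x y w, ∀ z ∈ L x y, ∃ z' ∈ L x w ∪ L w y, dist z z' ≤ h
  connected : ∀ x y (P : Set M), x ∈ P → y ∉ P →
    ∃ u ∈ L x y, ∃ v ∈ L x y, u ∈ P ∧ v ∉ P ∧ dist u v ≤ h

namespace IsGuess

variable {L : M → M → Set M} {h : ℝ}

lemma nonneg (hL : IsGuess L h) [Nonempty M] : 0 ≤ h := by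
  obtain ⟨x⟩ := ‹Nonempty M›
  simpa using hL.small x x (by simp) x (hL.left_mem x x)

/-- Halving a geodesic `n` times shows that `L` stays within a distance of its ends that is
logarithmic in its length. -/
lemma near_geodesic_of_length_le (hL : IsGuess L h) {γ : ℝ → M} (n : ℕ) {a b : ℝ} (hab : a ≤ b)
    (hγ : IsometricOn γ a b) (hn : b - a ≤ 2 ^ n) {z : M} (hz : z ∈ L (γ a) (γ b)) :
    ∃ s ∈ Set.Icc a b, dist z (γ s) ≤ h * (n + 1) := by
  induction n generalizing a b z with
  | zero =>
    refine ⟨a, ⟨le_rfl, hab⟩, ?_⟩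
    have hd : dist (γ a) (γ b) ≤ 1 := by
      rw [hγ a ⟨le_rfl, hab⟩ b ⟨hab, le_rfl⟩, abs_of_nonpos (by linarith)]
      simpa using hn
    simpa using hL.small _ _ hd z hz
  | succ n ih =>
    have h1 : a ≤ (a + b) / 2 := by linarith
    have h2 : (a + b) / 2 ≤ b := by linarith
    rw [pow_succ] at hn
    obtain ⟨z', hz', hd⟩ := hL.thin _ _ (γ ((a + b) / 2)) z hz
    push_cast
    rcases hz' with hz' | hz'
    · obtain ⟨s, hs, hs'⟩ := ih h1 (hγ.mono le_rfl h2) (by linarith) hz'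
      refine ⟨s, ⟨hs.1, hs.2.trans h2⟩, ?_⟩
      linarith [dist_triangle z z' (γ s)]
    · obtain ⟨s, hs, hs'⟩ := ih h2 (hγ.mono h1 le_rfl) (by linarith) hz'
      refine ⟨s, ⟨h1.trans hs.1, hs.2⟩, ?_⟩
      linarith [dist_triangle z z' (γ s)]

lemma exists_pow_bound (h : ℝ) : ∃ n : ℕ, 4 * h * (n + 3) + 8 * h + 2 ≤ 2 ^ n := by
  have hlin : (fun n : ℕ => 4 * h * ((n : ℝ) + 3) + 8 * h + 2) =o[Filter.atTop]
      fun n : ℕ => (2 : ℝ) ^ n := by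
    have h1 : (fun n : ℕ => (n : ℝ)) =o[Filter.atTop] fun n : ℕ => (2 : ℝ) ^ n := by
      simpa using isLittleO_pow_const_const_pow_of_one_lt (R := ℝ) 1 (r := 2) (by norm_num)
    have h2 : (fun _ : ℕ => (20 * h + 2 : ℝ)) =o[Filter.atTop] fun n : ℕ => (2 : ℝ) ^ n := by
      rw [Asymptotics.isLittleO_const_left]
      right
      exact tendsto_norm_atTop_atTop.comp
        (tendsto_pow_atTop_atTop_of_one_lt (by norm_num))
    refine ((h1.const_mul_left (4 * h)).add h2).congr_left fun n => ?_
    ring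
  obtain ⟨n, hn⟩ := (hlin.bound one_pos).exists
  refine ⟨n, (le_abs_self _).trans ?_⟩
  simpa using hn

/-- Guessed geodesics stay uniformly close to honest ones. A point of `L` near `γ s₀` is also near
`L` of a piece of `γ` of bounded length around `s₀`, to which the logarithmic bound applies. -/
lemma exists_near_geodesic (hL : IsGuess L h) [Nonempty M] :
    ∃ D : ℝ, 0 ≤ D ∧ ∀ (γ : ℝ → M) (a b : ℝ), a ≤ b → IsometricOn γ a b →
      ∀ z ∈ L (γ a) (γ b), ∃ s ∈ Set.Icc a b, dist z (γ s) ≤ D := by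
  have h0 := hL.nonneg
  obtain ⟨n, hn⟩ := exists_pow_bound h
  set D : ℝ := h * (n + 3) with hD
  have hn0 : (0 : ℝ) ≤ n := n.cast_nonneg
  have hD0 : 0 ≤ D := by positivity
  have hhD : h ≤ D := by nlinarith
  refine ⟨D, hD0, fun γ => ?_⟩
  suffices key : ∀ k : ℕ, ∀ a b : ℝ, a ≤ b → b - a ≤ k → IsometricOn γ a b →
      ∀ z ∈ L (γ a) (γ b), ∃ s ∈ Set.Icc a b, dist z (γ s) ≤ D from
    fun a b hab => key ⌈b - a⌉₊ a b hab (Nat.le_ceil _)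
  intro k
  induction k with
  | zero =>
    intro a b hab hk hγ z hz
    obtain ⟨s, hs, hs'⟩ := hL.near_geodesic_of_length_le 0 hab hγ
      (hk.trans (by norm_num)) hz
    exact ⟨s, hs, hs'.trans (by simpa using hhD)⟩
  | succ k ih =>
    intro a b hab hk hγ z hz
    by_cases hshort : b - a ≤ 1
    · obtain ⟨s, hs, hs'⟩ := hL.near_geodesic_of_length_le 0 hab hγ (by simpa using hshort) hz
      exact ⟨s, hs, hs'.trans (by simpa using hhD)⟩
    push_cast at hk
    have hk1 : (b - a) / 2 ≤ k := by
      have hk0 : (1 : ℝ) ≤ k := by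
        by_contra hcon
        have : k = 0 := by
          have : k < 1 := by exact_mod_cast not_le.1 hcon
          omega
        subst this
        norm_num at hk
        linarith
      linarith
    have hnear : ∃ s₀ ∈ Set.Icc a b, dist z (γ s₀) ≤ D + h := by
      have h1 : a ≤ (a + b) / 2 := by linarith
      have h2 : (a + b) / 2 ≤ b := by linarith
      obtain ⟨z', hz', hd⟩ := hL.thin _ _ (γ ((a + b) / 2)) z hz
      rcases hz' with hz' | hz'
      · obtain ⟨s, hs, hs'⟩ := ih _ _ h1 (by linarith) (hγ.mono le_rfl h2) z' hz'
        exact ⟨s, ⟨hs.1, hs.2.trans h2⟩, by linarith [dist_triangle z z' (γ s)]⟩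
      · obtain ⟨s, hs, hs'⟩ := ih _ _ h2 (by linarith) (hγ.mono h1 le_rfl) z' hz'
        exact ⟨s, ⟨h1.trans hs.1, hs.2⟩, by linarith [dist_triangle z z' (γ s)]⟩
    obtain ⟨s₀, hs₀, hzs₀⟩ := hnear
    -- If `z` were `2 * h`-close to `L` of a piece of `γ` at distance `R` from `γ s₀`, it would be
    -- within `D + 2 * h` of that piece, contradicting `dist z (γ s₀) ≤ D + h`.
    set R : ℝ := 2 * D + 4 * h + 1 with hR
    have hleft : ∃ a' ∈ Set.Icc a s₀, s₀ - a' ≤ R ∧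
        ∃ z' ∈ L (γ a') (γ b), dist z z' ≤ h := by
      by_cases hc : s₀ - R ≤ a
      · exact ⟨a, ⟨le_rfl, hs₀.1⟩, by linarith, z, hz, by simpa using h0⟩
      · push Not at hc
        refine ⟨s₀ - R, ⟨hc.le, by linarith⟩, by linarith, ?_⟩
        obtain ⟨z', hz' | hz', hd⟩ := hL.thin _ _ (γ (s₀ - R)) z hz
        · exfalso
          obtain ⟨s, hs, hs'⟩ := ih _ _ hc.le (by linarith [hs₀.2])
            (hγ.mono le_rfl (by linarith [hs₀.2])) z' hz'
          have h1 := hγ s ⟨hs.1, by linarith [hs.2, hs₀.2]⟩ s₀ hs₀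
          rw [abs_of_nonpos (by linarith [hs.2])] at h1
          have h2 := dist_triangle4 (γ s) z' z (γ s₀)
          rw [dist_comm (γ s) z', dist_comm z' z] at h2
          linarith [hs.2]
        · exact ⟨z', hz', hd⟩
    obtain ⟨a', ha', haR, z₁, hz₁, hzz₁⟩ := hleft
    have hright : ∃ b' ∈ Set.Icc s₀ b, b' - s₀ ≤ R ∧
        ∃ z' ∈ L (γ a') (γ b'), dist z₁ z' ≤ h := by
      by_cases hc : b ≤ s₀ + R
      · exact ⟨b, ⟨hs₀.2, le_rfl⟩, by linarith, z₁, hz₁, by simpa using h0⟩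
      · push Not at hc
        refine ⟨s₀ + R, ⟨by linarith, hc.le⟩, by linarith, ?_⟩
        obtain ⟨z', hz' | hz', hd⟩ := hL.thin _ _ (γ (s₀ + R)) z₁ hz₁
        · exact ⟨z', hz', hd⟩
        · exfalso
          obtain ⟨s, hs, hs'⟩ := ih _ _ hc.le (by linarith [hs₀.1])
            (hγ.mono (by linarith [hs₀.1]) le_rfl) z' hz'
          have h1 := hγ s ⟨by linarith [hs.1, hs₀.1], hs.2⟩ s₀ hs₀
          rw [abs_of_nonneg (by linarith [hs.1])] at h1
          have h2 := dist_triangle4 (γ s) z' z (γ s₀)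
          have h3 := dist_triangle z' z₁ z
          rw [dist_comm (γ s) z'] at h2
          rw [dist_comm z' z₁, dist_comm z₁ z] at h3
          linarith [hs.1]
    obtain ⟨b', hb', hbR, z₂, hz₂, hzz₂⟩ := hright
    obtain ⟨s, hs, hs'⟩ := hL.near_geodesic_of_length_le n (ha'.2.trans hb'.1)
      (hγ.mono ha'.1 hb'.2) (by linarith) hz₂
    refine ⟨s, ⟨ha'.1.trans hs.1, hs.2.trans hb'.2⟩, ?_⟩
    have := dist_triangle4 z z₁ z₂ (γ s)
    linarith

/-- **Guessing geodesics.** A geodesic space with a family of guessed geodesics is hyperbolic. -/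
theorem isHyperbolicSpace (hL : IsGuess L h) [Nonempty M] (hM : IsGeodesicSpace M) :
    IsHyperbolicSpace M := by
  have h0 := hL.nonneg
  obtain ⟨D, hD0, hD⟩ := hL.exists_near_geodesic
  have near : ∀ (x y : M) (σ : Set M), IsGeodesicSegment x y σ → ∀ z ∈ L x y,
      ∃ q ∈ σ, dist z q ≤ D := by
    rintro x y _ ⟨ℓ, γ, hℓ, rfl, rfl, hγ, rfl⟩ z hz
    obtain ⟨s, hs, hs'⟩ := hD γ 0 ℓ hℓ hγ z hz
    exact ⟨γ s, ⟨s, hs, rfl⟩, hs'⟩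
  refine ⟨hM, 4 * D + 2 * h, by positivity, fun x y z σ₁ σ₂ σ₃ h₁ h₂ h₃ p hp => ?_⟩
  -- Conversely a geodesic stays close to `L x y`: otherwise the part of `L x y` shadowing the
  -- first half of the geodesic would be cut off from the rest.
  have back : ∃ q ∈ L x y, dist p q ≤ 3 * D + h := by
    obtain ⟨ℓ, γ, hℓ, rfl, rfl, hγ, rfl⟩ := h₁
    obtain ⟨s, hs, rfl⟩ := hp
    let P : Set M := {u | ∃ s' ∈ Set.Icc 0 s, dist u (γ s') ≤ D}
    have hP0 : γ 0 ∈ P := ⟨0, ⟨le_rfl, hs.1⟩, by simpa using hD0⟩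
    by_cases hPℓ : γ ℓ ∈ P
    · obtain ⟨s', hs', hd⟩ := hPℓ
      refine ⟨γ ℓ, hL.right_mem _ _, ?_⟩
      rw [hγ ℓ ⟨hℓ, le_rfl⟩ s' ⟨hs'.1, hs'.2.trans hs.2⟩,
        abs_of_nonneg (by linarith [hs'.2, hs.2])] at hd
      rw [hγ s hs ℓ ⟨hℓ, le_rfl⟩, abs_of_nonpos (by linarith [hs.2])]
      linarith [hs'.2]
    · obtain ⟨u, hu, v, hv, ⟨s', hs', hus'⟩, hvP, huv⟩ := hL.connected _ _ P hP0 hPℓ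
      obtain ⟨s'', hs'', hvs''⟩ := hD γ 0 ℓ hℓ hγ v hv
      have hlt : s < s'' := by
        by_contra hcon
        exact hvP ⟨s'', ⟨hs''.1, not_lt.1 hcon⟩, hvs''⟩
      refine ⟨u, hu, ?_⟩
      have hs'ℓ : s' ∈ Set.Icc 0 ℓ := ⟨hs'.1, hs'.2.trans hs.2⟩
      have e1 := hγ s' hs'ℓ s'' hs''
      rw [abs_of_nonpos (by linarith [hs'.2])] at e1
      have e2 := hγ s hs s' hs'ℓ
      rw [abs_of_nonneg (by linarith [hs'.2])] at e2
      have e3 := dist_triangle4 (γ s') u v (γ s'')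
      rw [dist_comm (γ s') u] at e3
      have e4 := dist_triangle (γ s) (γ s') u
      rw [dist_comm (γ s') u] at e4
      linarith
  obtain ⟨q, hq, hpq⟩ := back
  obtain ⟨q', hq' | hq', hqq'⟩ := hL.thin x y z q hq
  · obtain ⟨r, hr, hd⟩ := near _ _ _ h₃.reverse q' hq'
    exact ⟨r, .inr hr, by linarith [dist_triangle4 p q q' r]⟩
  · obtain ⟨r, hr, hd⟩ := near _ _ _ h₂.reverse q' hq'
    exact ⟨r, .inl hr, by linarith [dist_triangle4 p q q' r]⟩

end IsGuess

end Criterion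

/-! ### Geodesics in metric 1-complexes -/

section Lipschitz

variable {M : Type u} [MetricSpace M]

/-- `γ` is a 1-Lipschitz path on `[0, ℓ]` from `x` to `y`. -/
structure IsLipPath (γ : ℝ → M) (ℓ : ℝ) (x y : M) : Prop where
  nonneg : 0 ≤ ℓ
  source : γ 0 = x
  target : γ ℓ = y
  dist_le : ∀ s ∈ Set.Icc 0 ℓ, ∀ t ∈ Set.Icc 0 ℓ, s ≤ t → dist (γ s) (γ t) ≤ t - s

/-- A 1-Lipschitz path no longer than the distance of its ends is a geodesic. -/
lemma IsLipPath.isGeodesicSegment {γ : ℝ → M} {ℓ : ℝ} {x y : M} (h : IsLipPath γ ℓ x y)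
    (hℓ : ℓ ≤ dist x y) : IsGeodesicSegment x y (γ '' Set.Icc 0 ℓ) := by
  have key : ∀ s ∈ Set.Icc 0 ℓ, ∀ t ∈ Set.Icc 0 ℓ, s ≤ t → dist (γ s) (γ t) = |s - t| := by
    intro s hs t ht hst
    have h1 := h.dist_le 0 ⟨le_rfl, h.nonneg⟩ s hs hs.1
    have h2 := h.dist_le t ht ℓ ⟨h.nonneg, le_rfl⟩ ht.2
    have h3 := h.dist_le s hs t ht hst
    have h4 := dist_triangle4 (γ 0) (γ s) (γ t) (γ ℓ)
    rw [h.source, h.target] at h4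
    rw [h.source] at h1
    rw [h.target] at h2
    rw [abs_of_nonpos (by linarith)]
    linarith
  refine ⟨ℓ, γ, h.nonneg, h.source, h.target, fun s hs t ht => ?_, rfl⟩
  rcases le_total s t with hst | hst
  · exact key s hs t ht hst
  · rw [dist_comm, key t ht s hs hst, abs_sub_comm]

lemma IsGeodesicSegment.exists_isLipPath {x y : M} {σ : Set M} (h : IsGeodesicSegment x y σ) :
    ∃ γ, IsLipPath γ (dist x y) x y := by
  obtain ⟨ℓ, γ, hℓ, rfl, rfl, hγ, rfl⟩ := h
  have : dist (γ 0) (γ ℓ) = ℓ := by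
    rw [hγ 0 ⟨le_rfl, hℓ⟩ ℓ ⟨hℓ, le_rfl⟩, abs_of_nonpos (by linarith)]
    ring
  rw [this]
  refine ⟨γ, hℓ, rfl, rfl, fun s hs t ht hst => ?_⟩
  rw [hγ s hs t ht, abs_of_nonpos (by linarith)]
  linarith

lemma IsLipPath.reverse {γ : ℝ → M} {ℓ : ℝ} {x y : M} (h : IsLipPath γ ℓ x y) :
    IsLipPath (fun s => γ (ℓ - s)) ℓ y x := by
  refine ⟨h.nonneg, by simpa using h.target, by simpa using h.source, fun s hs t ht hst => ?_⟩
  rw [dist_comm]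
  have := h.dist_le (ℓ - t) ⟨by linarith [ht.2], by linarith [ht.1]⟩ (ℓ - s)
    ⟨by linarith [hs.2], by linarith [hs.1]⟩ (by linarith)
  linarith

lemma IsLipPath.trans {γ₁ γ₂ : ℝ → M} {k ℓ : ℝ} {x y z : M} (h₁ : IsLipPath γ₁ k x y)
    (h₂ : IsLipPath γ₂ ℓ y z) : ∃ γ, IsLipPath γ (k + ℓ) x z ∧ γ k = y := by
  have hk := h₁.nonneg
  have hℓ := h₂.nonneg
  have glue : ∀ s, k ≤ s → (if s ≤ k then γ₁ s else γ₂ (s - k)) = γ₂ (s - k) := by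
    intro s hs
    split_ifs with h
    · obtain rfl : s = k := le_antisymm h hs
      rw [h₁.target, sub_self, h₂.source]
    · rfl
  refine ⟨fun s => if s ≤ k then γ₁ s else γ₂ (s - k), ⟨by positivity, ?_, ?_, ?_⟩, ?_⟩
  · simpa [hk] using h₁.source
  · rw [glue _ (by linarith), add_sub_cancel_left, h₂.target]
  · intro s hs t ht hst
    rcases le_total t k with htk | htk
    · rw [if_pos htk, if_pos (hst.trans htk)]
      exact h₁.dist_le s ⟨hs.1, hst.trans htk⟩ t ⟨ht.1, htk⟩ hst
    · rw [glue t htk]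
      have e2 : dist y (γ₂ (t - k)) ≤ t - k := by
        have := h₂.dist_le 0 ⟨le_rfl, hℓ⟩ (t - k) ⟨by linarith, by linarith [ht.2]⟩ (by linarith)
        rw [h₂.source] at this
        linarith
      rcases le_total s k with hsk | hsk
      · rw [if_pos hsk]
        have e1 := h₁.dist_le s ⟨hs.1, hsk⟩ k ⟨hk, le_rfl⟩ hsk
        rw [h₁.target] at e1
        linarith [dist_triangle (γ₁ s) y (γ₂ (t - k))]
      · rw [glue s hsk]
        have := h₂.dist_le (s - k) ⟨by linarith, by linarith [hs.2]⟩ (t - k)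
          ⟨by linarith, by linarith [ht.2]⟩ (by linarith)
        linarith
  · simpa using h₁.target

lemma exists_isLipPath_refl (x : M) : ∃ γ, IsLipPath γ 0 x x :=
  ⟨fun _ => x, le_rfl, rfl, rfl, fun s _ t _ hst => by simpa using hst⟩

/-- In a geodesic space, a point between `x` and `y` lies on a geodesic from `x` to `y`. -/
lemma IsGeodesicSpace.exists_segment_through (hM : IsGeodesicSpace M) {x y z : M}
    (h : dist x z + dist z y = dist x y) : ∃ σ, IsGeodesicSegment x y σ ∧ z ∈ σ := by
  obtain ⟨σ₁, h₁⟩ := hM x z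
  obtain ⟨σ₂, h₂⟩ := hM z y
  obtain ⟨γ₁, h₁⟩ := h₁.exists_isLipPath
  obtain ⟨γ₂, h₂⟩ := h₂.exists_isLipPath
  obtain ⟨γ, hγ, hz⟩ := h₁.trans h₂
  exact ⟨_, hγ.isGeodesicSegment h.le,
    _, ⟨dist_nonneg, by linarith [dist_nonneg (x := z) (y := y)]⟩, hz⟩

end Lipschitz

namespace OrientedGraph

variable {V : Type u} {E : Type v} {Γ : OrientedGraph V E}

lemma Point.gap_le_one (p : Γ.Point) (i : Bool) : p.gap i ≤ 1 := by
  rcases p with x | ⟨e, r, h0, h1⟩ <;> cases i <;> simp [Point.gap, *]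

/-- The position of a point on its edge; `0` for a vertex. -/
def Point.coord : Γ.Point → ℝ
  | vertex _ => 0
  | onEdge _ r => r

/-- The infimum defining the distance is attained: a pair of points has at most five routes. -/
lemma route_pointDist (p q : Γ.Point) : Route p q (pointDist p q) := by
  have hfin : {ℓ | Route p q ℓ}.Finite := by
    refine Set.Finite.subset ((Set.finite_singleton |p.coord - q.coord|).union
      (Set.finite_range fun ij : Bool × Bool =>
        p.gap ij.1 + Γ.skeleton.dist (p.foot ij.1) (q.foot ij.2) + q.gap ij.2)) ?_
    rintro ℓ (⟨e, r, s⟩ | ⟨_, _, i, j⟩)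
    · exact .inl rfl
    · exact .inr ⟨(i, j), rfl⟩
  exact Set.Nonempty.csInf_mem ⟨_, .through p q true true⟩ hfin

lemma toRealization_eq_of_route {hΓ : Γ.skeleton.Connected} {p q : Γ.Point} (h : Route p q 0) :
    toRealization hΓ p = toRealization hΓ q := by
  rw [← dist_le_zero, dist_toRealization]
  exact pointDist_le h

/-- The point of the edge `e` at distance `0` or `1` from its origin is an end of `e`. -/
lemma toRealization_foot (hΓ : Γ.skeleton.Connected) (e : E) (i : Bool) :
    toRealization hΓ (.vertex (Point.foot (Γ := Γ) (.onEdge e 0) i)) =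
      toRealization hΓ (.onEdge e (if i then 1 else 0)) := by
  apply toRealization_eq_of_route
  have := Route.through (Γ := Γ) (.vertex (Point.foot (Γ := Γ) (.onEdge e 0) i))
    (.onEdge e (if i then 1 else 0)) true i
  cases i <;> simpa [Point.gap, Point.foot] using this

lemma exists_isLipPath_edge (hΓ : Γ.skeleton.Connected) (e : E) (r s : Set.Icc (0 : ℝ) 1) :
    ∃ γ, IsLipPath γ |(r : ℝ) - s| (toRealization hΓ (.onEdge e r))
      (toRealization hΓ (.onEdge e s)) := by
  wlog hrs : r ≤ s generalizing r s
  · obtain ⟨γ, hγ⟩ := this s r (le_of_not_ge hrs)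
    rw [abs_sub_comm]
    exact ⟨_, hγ.reverse⟩
  have hrs' : (r : ℝ) ≤ s := hrs
  rw [abs_of_nonpos (by linarith), neg_sub]
  refine ⟨fun a => toRealization hΓ (.onEdge e (Set.projIcc 0 1 zero_le_one (r + a))),
    by linarith, by simp, by simp, fun a ha b hb hab => ?_⟩
  rw [dist_toRealization]
  refine (pointDist_le (.along e _ _)).trans ?_
  rw [Set.projIcc_of_mem _ (⟨by linarith [r.2.1, ha.1], by linarith [s.2.2, ha.2]⟩ :
      (r : ℝ) + a ∈ Set.Icc (0 : ℝ) 1),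
    Set.projIcc_of_mem _ (⟨by linarith [r.2.1, hb.1], by linarith [s.2.2, hb.2]⟩ :
      (r : ℝ) + b ∈ Set.Icc (0 : ℝ) 1), abs_of_nonpos (by dsimp only; linarith)]
  dsimp only
  linarith

lemma exists_isLipPath_foot (hΓ : Γ.skeleton.Connected) (p : Γ.Point) (i : Bool) :
    ∃ γ, IsLipPath γ (p.gap i) (toRealization hΓ p) (toRealization hΓ (.vertex (p.foot i))) := by
  rcases p with x | ⟨e, r⟩
  · exact exists_isLipPath_refl _
  · obtain ⟨γ, hγ⟩ := exists_isLipPath_edge hΓ e r (if i then 1 else 0)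
    rw [← toRealization_foot hΓ e i, foot_same_edge e 0 r] at hγ
    refine ⟨γ, ?_⟩
    convert hγ using 1
    cases i
    · simp [Point.gap, abs_of_nonneg r.2.1]
    · have : (r : ℝ) - 1 ≤ 0 := by linarith [r.2.2]
      simp [Point.gap, abs_of_nonpos this]

lemma exists_isLipPath_adj (hΓ : Γ.skeleton.Connected) {x y : V} (h : Γ.skeleton.Adj x y) :
    ∃ γ, IsLipPath γ 1 (toRealization hΓ (.vertex x)) (toRealization hΓ (.vertex y)) := by
  have key : ∀ e : E, ∃ γ, IsLipPath γ 1 (toRealization hΓ (.vertex (Γ.src e)))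
      (toRealization hΓ (.vertex (Γ.tgt e))) := by
    intro e
    have h0 := toRealization_foot hΓ e false
    have h1 := toRealization_foot hΓ e true
    simp only [Point.foot, Bool.false_eq_true, if_false, if_true] at h0 h1
    rw [h0, h1]
    simpa using exists_isLipPath_edge hΓ e 0 1
  simp only [skeleton, SimpleGraph.fromRel_adj] at h
  obtain ⟨-, ⟨e, rfl, rfl⟩ | ⟨e, rfl, rfl⟩⟩ := h
  · exact key e
  · obtain ⟨γ, hγ⟩ := key e
    exact ⟨_, hγ.reverse⟩

lemma exists_isLipPath_walk (hΓ : Γ.skeleton.Connected) {x y : V} (w : Γ.skeleton.Walk x y) :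
    ∃ γ, IsLipPath γ w.length (toRealization hΓ (.vertex x)) (toRealization hΓ (.vertex y)) := by
  induction w with
  | nil => simpa using exists_isLipPath_refl _
  | cons h w ih =>
    obtain ⟨γ₁, h₁⟩ := exists_isLipPath_adj hΓ h
    obtain ⟨γ₂, h₂⟩ := ih
    obtain ⟨γ, hγ, -⟩ := h₁.trans h₂
    refine ⟨γ, ?_⟩
    rwa [SimpleGraph.Walk.length_cons, Nat.cast_add, Nat.cast_one, add_comm]

lemma exists_isLipPath_route (hΓ : Γ.skeleton.Connected) {p q : Γ.Point} {ℓ : ℝ}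
    (h : Route p q ℓ) : ∃ γ, IsLipPath γ ℓ (toRealization hΓ p) (toRealization hΓ q) := by
  cases h with
  | along e r s => exact exists_isLipPath_edge hΓ e r s
  | through _ _ i j =>
    obtain ⟨w, hw⟩ := hΓ.exists_walk_length_eq_dist (p.foot i) (q.foot j)
    obtain ⟨γ₁, h₁⟩ := exists_isLipPath_foot hΓ p i
    obtain ⟨γ₂, h₂⟩ := exists_isLipPath_walk hΓ w
    obtain ⟨γ₃, h₃⟩ := exists_isLipPath_foot hΓ q j
    obtain ⟨γ, hγ, -⟩ := h₁.trans h₂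
    obtain ⟨γ', hγ', -⟩ := hγ.trans h₃.reverse
    rw [hw] at hγ'
    exact ⟨γ', hγ'⟩

theorem isGeodesicSpace_realization (hΓ : Γ.skeleton.Connected) :
    IsGeodesicSpace (Realization hΓ) := by
  intro x y
  obtain ⟨p, rfl⟩ := toRealization_surjective hΓ x
  obtain ⟨q, rfl⟩ := toRealization_surjective hΓ y
  obtain ⟨γ, hγ⟩ := exists_isLipPath_route hΓ (route_pointDist p q)
  exact ⟨_, hγ.isGeodesicSegment le_rfl⟩

lemma dist_toRealization_foot_le (hΓ : Γ.skeleton.Connected) (p : Γ.Point) (i : Bool) :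
    dist (toRealization hΓ p) (toRealization hΓ (.vertex (p.foot i))) ≤ p.gap i := by
  rw [dist_toRealization]
  have := pointDist_le (Route.through p (.vertex (p.foot i)) i true)
  simpa [Point.gap, Point.foot] using this

lemma exists_vertex_near (hΓ : Γ.skeleton.Connected) (q : Realization hΓ) :
    ∃ v : V, dist q (toRealization hΓ (.vertex v)) ≤ 1 := by
  obtain ⟨p, rfl⟩ := toRealization_surjective hΓ q
  exact ⟨p.foot true, (dist_toRealization_foot_le hΓ p true).trans (p.gap_le_one true)⟩

/-- A point between two vertices has a vertex between them nearby: the first foot passed. -/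
lemma exists_vertex_between (hΓ : Γ.skeleton.Connected) {x w : V} {q : Realization hΓ}
    (h : dist (toRealization hΓ (.vertex x)) q + dist q (toRealization hΓ (.vertex w)) =
      dist (toRealization hΓ (.vertex x)) (toRealization hΓ (.vertex w))) :
    ∃ v : V, dist q (toRealization hΓ (.vertex v)) ≤ 1 ∧
      Γ.skeleton.dist x v + Γ.skeleton.dist v w = Γ.skeleton.dist x w := by
  obtain ⟨p, rfl⟩ := toRealization_surjective hΓ q
  rw [dist_toRealization_vertex, dist_toRealization, dist_toRealization] at h
  have through_left : ∀ ℓ, Route (.vertex x) p ℓ →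
      ∃ i, ℓ = Γ.skeleton.dist x (p.foot i) + p.gap i := by
    intro ℓ hℓ
    cases hℓ with
    | through _ _ _ i => exact ⟨i, by simp [Point.gap, Point.foot]⟩
  have through_right : ∀ ℓ, Route p (.vertex w) ℓ →
      ∃ i, ℓ = p.gap i + Γ.skeleton.dist (p.foot i) w := by
    intro ℓ hℓ
    cases hℓ with
    | through _ _ i _ => exact ⟨i, by simp [Point.gap, Point.foot]⟩
  obtain ⟨i, hi⟩ := through_left _ (route_pointDist _ _)
  obtain ⟨j, hj⟩ := through_right _ (route_pointDist _ _)
  refine ⟨p.foot i, (dist_toRealization_foot_le hΓ p i).trans (p.gap_le_one i),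
    le_antisymm ?_ hΓ.dist_triangle⟩
  have h1 := p.dist_foot_le i j
  have h2 : (Γ.skeleton.dist (p.foot i) w : ℝ) ≤
      Γ.skeleton.dist (p.foot i) (p.foot j) + Γ.skeleton.dist (p.foot j) w := by
    exact_mod_cast hΓ.dist_triangle
  have : (Γ.skeleton.dist x (p.foot i) + Γ.skeleton.dist (p.foot i) w : ℝ) ≤
      Γ.skeleton.dist x w := by linarith
  exact_mod_cast this

end OrientedGraph

/-! ### Thin intervals in graphs -/

/-- Triangles of intervals in the graph `Δ` are `N`-thin, where the interval between two vertices
is the union of all geodesics joining them. -/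
def SimpleGraph.HasThinIntervals {V : Type u} (Δ : SimpleGraph V) (N : ℕ) : Prop :=
  ∀ x y w z : V, Δ.dist x z + Δ.dist z y = Δ.dist x y → ∃ z', Δ.dist z z' ≤ N ∧
    (Δ.dist x z' + Δ.dist z' w = Δ.dist x w ∨ Δ.dist w z' + Δ.dist z' y = Δ.dist w y)

namespace OrientedGraph

variable {V : Type u} {E : Type v} {Γ : OrientedGraph V E}

theorem hasThinIntervals_of_isHyperbolicSpace {hΓ : Γ.skeleton.Connected}
    (h : IsHyperbolicSpace (Realization hΓ)) : ∃ N, Γ.skeleton.HasThinIntervals N := by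
  obtain ⟨hgeo, δ, hδ, hthin⟩ := h
  refine ⟨⌈δ + 1⌉₊, fun x y w z hz => ?_⟩
  let ι : V → Realization hΓ := fun v => toRealization hΓ (.vertex v)
  have hι : ∀ a b, dist (ι a) (ι b) = Γ.skeleton.dist a b := dist_toRealization_vertex hΓ
  obtain ⟨σ₁, h₁, hzσ⟩ := hgeo.exists_segment_through (x := ι x) (y := ι y) (z := ι z)
    (by rw [hι, hι, hι]; exact_mod_cast hz)
  obtain ⟨σ₂, h₂⟩ := hgeo (ι y) (ι w)
  obtain ⟨σ₃, h₃⟩ := hgeo (ι w) (ι x)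
  obtain ⟨q, hq, hzq⟩ := hthin _ _ _ _ _ _ h₁ h₂ h₃ _ hzσ
  have finish : ∀ v, dist q (ι v) ≤ 1 → Γ.skeleton.dist z v ≤ ⌈δ + 1⌉₊ := by
    intro v hv
    have h1 : (Γ.skeleton.dist z v : ℝ) ≤ δ + 1 := by
      rw [← hι]
      linarith [dist_triangle (ι z) q (ι v)]
    exact_mod_cast h1.trans (Nat.le_ceil _)
  rcases hq with hq | hq
  · obtain ⟨v, hv, hv'⟩ := exists_vertex_between hΓ (h₂.reverse.dist_add_dist hq)
    exact ⟨v, finish v hv, .inr hv'⟩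
  · obtain ⟨v, hv, hv'⟩ := exists_vertex_between hΓ (h₃.reverse.dist_add_dist hq)
    exact ⟨v, finish v hv, .inl hv'⟩

/-- The guessing-geodesics criterion for graphs, with the sets `L x y` given for vertices only. -/
theorem isHyperbolicSpace_of_vertex_guess (hΓ : Γ.skeleton.Connected) (L : V → V → Set V) (C : ℕ)
    (left_mem : ∀ x y, x ∈ L x y) (right_mem : ∀ x y, y ∈ L x y)
    (small : ∀ x y, Γ.skeleton.Adj x y → ∀ z ∈ L x y, Γ.skeleton.dist z x ≤ C)
    (small_self : ∀ x, ∀ z ∈ L x x, Γ.skeleton.dist z x ≤ C)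
    (thin : ∀ x y w, ∀ z ∈ L x y, ∃ z' ∈ L x w ∪ L w y, Γ.skeleton.dist z z' ≤ C)
    (connected : ∀ x y (P : Set V), x ∈ P → y ∉ P →
      ∃ u ∈ L x y, ∃ v ∈ L x y, u ∈ P ∧ v ∉ P ∧ Γ.skeleton.dist u v ≤ C) :
    IsHyperbolicSpace (Realization hΓ) := by
  -- thin triangles propagate smallness along walks
  have small_walk : ∀ {x y : V} (w : Γ.skeleton.Walk x y), ∀ z ∈ L x y,
      Γ.skeleton.dist z x ≤ (2 * C + 1) * w.length + C := by
    intro x y w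
    induction w with
    | nil => simpa using small_self _
    | @cons a b c hab w ih =>
      intro z hz
      obtain ⟨z', hz' | hz', hd⟩ := thin _ _ b z hz
      · have h1 := small _ _ hab z' hz'
        have h2 := hΓ.dist_triangle (u := z) (v := z') (w := a)
        rw [SimpleGraph.Walk.length_cons]
        nlinarith [Nat.zero_le (C * w.length)]
      · have h1 := ih z' hz'
        have h2 := hΓ.dist_triangle (u := z) (v := z') (w := a)
        have h3 := hΓ.dist_triangle (u := z') (v := b) (w := a)
        have h4 := SimpleGraph.dist_eq_one_iff_adj.2 hab.symm
        rw [SimpleGraph.Walk.length_cons]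
        nlinarith
  let ι : V → Realization hΓ := fun v => toRealization hΓ (.vertex v)
  have hι : ∀ a b, dist (ι a) (ι b) = Γ.skeleton.dist a b := dist_toRealization_vertex hΓ
  choose v hv using exists_vertex_near hΓ
  have hne : Nonempty (Realization hΓ) := ⟨ι hΓ.nonempty.some⟩
  have hC0 : (0 : ℝ) ≤ C := C.cast_nonneg
  refine IsGuess.isHyperbolicSpace (L := fun p q => {p, q} ∪ ι '' L (v p) (v q))
    (h := (2 * C + 1) * 3 + C + 1) ?_ (isGeodesicSpace_realization hΓ)
  constructor
  · exact fun p q => .inl (.inl rfl)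
  · exact fun p q => .inl (.inr rfl)
  · rintro p q hpq z ((rfl | rfl) | ⟨z, hz, rfl⟩)
    · rw [dist_self]; positivity
    · rw [dist_comm]; linarith
    · have h3 : (Γ.skeleton.dist (v p) (v q) : ℝ) ≤ 3 := by
        rw [← hι]
        have := dist_triangle4 (ι (v p)) p q (ι (v q))
        rw [dist_comm (ι (v p)) p] at this
        linarith [hv p, hv q]
      obtain ⟨w, hw⟩ := hΓ.exists_walk_length_eq_dist (v p) (v q)
      have h4 : (Γ.skeleton.dist z (v p) : ℝ) ≤ (2 * C + 1) * w.length + C := by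
        exact_mod_cast small_walk w z hz
      rw [hw] at h4
      rw [← hι] at h4
      have h5 := dist_triangle (ι z) (ι (v p)) p
      rw [dist_comm (ι (v p)) p] at h5
      have := hv p
      change dist p (ι (v p)) ≤ 1 at this
      nlinarith
  · rintro p q w z ((rfl | rfl) | ⟨z, hz, rfl⟩)
    · exact ⟨_, .inl (.inl (.inl rfl)), by rw [dist_self]; positivity⟩
    · exact ⟨_, .inr (.inl (.inr rfl)), by rw [dist_self]; positivity⟩
    · obtain ⟨z', hz', hd⟩ := thin _ _ (v w) z hz
      have hd' : dist (ι z) (ι z') ≤ C := by rw [hι]; exact_mod_cast hd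
      rcases hz' with hz' | hz'
      · exact ⟨ι z', .inl (.inr ⟨z', hz', rfl⟩), by linarith⟩
      · exact ⟨ι z', .inr (.inr ⟨z', hz', rfl⟩), by linarith⟩
  · intro p q P hp hq
    by_cases hvp : ι (v p) ∈ P
    · by_cases hvq : ι (v q) ∈ P
      · refine ⟨ι (v q), .inr ⟨_, right_mem _ _, rfl⟩, q, .inl (.inr rfl), hvq, hq, ?_⟩
        rw [dist_comm]
        have := hv q
        change dist q (ι (v q)) ≤ 1 at this
        linarith
      · obtain ⟨a, ha, b, hb, haP, hbP, hd⟩ := connected (v p) (v q) (ι ⁻¹' P) hvp hvq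
        refine ⟨ι a, .inr ⟨a, ha, rfl⟩, ι b, .inr ⟨b, hb, rfl⟩, haP, hbP, ?_⟩
        have hd' : dist (ι a) (ι b) ≤ C := by rw [hι]; exact_mod_cast hd
        linarith
    · refine ⟨p, .inl (.inl rfl), ι (v p), .inr ⟨_, left_mem _ _, rfl⟩, hp, hvp, ?_⟩
      have := hv p
      change dist p (ι (v p)) ≤ 1 at this
      linarith

end OrientedGraph

/-! ### Branches of an HNN extension at a coset of the base group -/

namespace HNNExtension

open NormalWord

variable {H : Type u} [Group H] {A B : Subgroup H} {φ : A ≃* B}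

/-- There are transversals containing `1`. -/
lemma exists_transversalPair_one_mem (A B : Subgroup H) :
    ∃ d : TransversalPair H A B, ∀ u, 1 ∈ d.set u := by
  choose T hT using fun u => (toSubgroup A B u).exists_isComplement_right 1
  exact ⟨⟨T, fun u => (hT u).1⟩, fun u => (hT u).2⟩

section LastLetter

variable (d : TransversalPair H A B)

/-- The last letter `t ^ u * h` of the normal form of `g⁻¹`, or `none` if `g` lies in the base
group. Read backwards, this is the first letter of `g`: it tells by which edge of the Bass–Serre
tree a path from the base vertex to the vertex of `g` sets out. -/
def lastLetter (g : HNNExtension H A B φ) : Option (ℤˣ × H) :=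
  (NormalWord.equiv φ d g⁻¹).toList.getLast?

lemma equiv_mul (g k : HNNExtension H A B φ) :
    NormalWord.equiv φ d (g * k) = g • NormalWord.equiv φ d k :=
  mul_smul g k _

lemma toList_unitsSMul_of_cancels {u : ℤˣ} {w : NormalWord d} (h : Cancels u w) :
    ∃ x, w.toList = x :: (unitsSMul φ u w).toList := by
  rw [unitsSMul, dif_pos h]
  cases w using consRecOn with
  | ofGroup => simp [Cancels] at h
  | cons g u' w h1 h2 _ => exact ⟨(u', w.head), rfl⟩

lemma toList_unitsSMul_of_not_cancels {u : ℤˣ} {w : NormalWord d} (h : ¬ Cancels u w) :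
    (unitsSMul φ u w).toList = (u, ((d.compl u).equiv w.head).2.1) :: w.toList := by
  rw [unitsSMul, dif_neg h]
  simp [unitsSMulGroup_snd]

lemma getLast?_unitsSMul {u : ℤˣ} {w : NormalWord d} (hw : w.toList ≠ [])
    (hw' : (unitsSMul φ u w).toList ≠ []) :
    (unitsSMul φ u w).toList.getLast? = w.toList.getLast? := by
  by_cases h : Cancels u w
  · obtain ⟨x, hx⟩ := toList_unitsSMul_of_cancels (φ := φ) d h
    rw [hx, List.getLast?_cons_of_ne_nil hw']
  · rw [toList_unitsSMul_of_not_cancels d h, List.getLast?_cons_of_ne_nil hw]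

lemma equiv_of (h : H) :
    NormalWord.equiv φ d (of h) = NormalWord.ofGroup h := by
  change (of h : HNNExtension H A B φ) • (empty : NormalWord d) = _
  rw [of_smul_eq_smul]
  ext <;> simp

lemma equiv_toList_eq_nil_iff {g : HNNExtension H A B φ} :
    (NormalWord.equiv φ d g).toList = [] ↔ g ∈ (of : H →* HNNExtension H A B φ).range := by
  constructor
  · intro h
    refine ⟨(NormalWord.equiv φ d g).head, ?_⟩
    have h1 : (NormalWord.equiv φ d g).prod φ = g := (NormalWord.equiv φ d).symm_apply_apply g
    conv_rhs => rw [← h1]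
    rw [ReducedWord.prod, h]
    simp
  · rintro ⟨h, rfl⟩
    rw [equiv_of]
    rfl

lemma lastLetter_mul_of {g : HNNExtension H A B φ} (h : H) :
    lastLetter d (g * of h) = lastLetter d g := by
  rw [lastLetter, mul_inv_rev, equiv_mul, ← map_inv, of_smul_eq_smul]
  rfl

/-- A step `t ^ u` between points outside the base group adds or cancels a letter at the head of the
normal form of the inverse, so it does not affect the last letter. -/
lemma lastLetter_mul_t_zpow {g : HNNExtension H A B φ} {u : ℤˣ}
    (hg : g ∉ (of : H →* HNNExtension H A B φ).range)
    (hgt : g * t ^ (u : ℤ) ∉ (of : H →* HNNExtension H A B φ).range) :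
    lastLetter d (g * t ^ (u : ℤ)) = lastLetter d g := by
  have e : (g * t ^ (u : ℤ))⁻¹ = t ^ ((-u : ℤˣ) : ℤ) * g⁻¹ := by simp
  have e' : NormalWord.equiv φ d (g * t ^ (u : ℤ))⁻¹ =
      unitsSMul φ (-u) (NormalWord.equiv φ d g⁻¹) := by
    rw [e, equiv_mul, t_pow_smul_eq_unitsSMul]
  have hgt' : (NormalWord.equiv φ d (g * t ^ (u : ℤ))⁻¹).toList ≠ [] := fun h =>
    hgt (inv_mem_iff.1 ((equiv_toList_eq_nil_iff d).1 h))
  have hg' : (NormalWord.equiv φ d g⁻¹).toList ≠ [] := fun h =>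
    hg (inv_mem_iff.1 ((equiv_toList_eq_nil_iff d).1 h))
  rw [e'] at hgt'
  rw [lastLetter, e', getLast?_unitsSMul d hg' hgt', lastLetter]

lemma lastLetter_of_mul_t_zpow (h : H) (u : ℤˣ) :
    lastLetter d (of h * t ^ (u : ℤ) : HNNExtension H A B φ) =
      some (-u, ((d.compl (-u)).equiv h⁻¹).2.1) := by
  have e : (of h * t ^ (u : ℤ) : HNNExtension H A B φ)⁻¹ = t ^ ((-u : ℤˣ) : ℤ) * of h⁻¹ := by simp
  have hc : ¬ Cancels (-u) (NormalWord.ofGroup h⁻¹ : NormalWord d) := by simp [Cancels]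
  rw [lastLetter, e, equiv_mul, t_pow_smul_eq_unitsSMul, equiv_of,
    toList_unitsSMul_of_not_cancels d hc]
  simp

/-- The edge from the base vertex to its neighbour `t ^ u` separates: no `y` lies both beyond that
edge as seen from the base vertex and beyond it as seen from the neighbour. If the normal form of
`y⁻¹` ends in `t ^ (-u)`, then that of `y⁻¹ * t ^ u` is obtained by dropping this letter, and
cannot end in `t ^ u` as the word was reduced. -/
lemma lastLetter_separation (hd : ∀ u, 1 ∈ d.set u) (u : ℤˣ) (y : HNNExtension H A B φ)
    (h₁ : lastLetter d y = lastLetter d (t ^ (u : ℤ) : HNNExtension H A B φ)) :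
    lastLetter d (t ^ ((-u : ℤˣ) : ℤ) * y) ≠
      lastLetter d (t ^ ((-u : ℤˣ) : ℤ) : HNNExtension H A B φ) := by
  have hone : ∀ u : ℤˣ, lastLetter d (t ^ (u : ℤ) : HNNExtension H A B φ) = some (-u, 1) := by
    intro u
    have := lastLetter_of_mul_t_zpow (φ := φ) d 1 u
    rw [map_one, one_mul] at this
    rw [this, inv_one,
      (d.compl (-u)).equiv_snd_eq_inv_mul,
      (d.compl (-u)).equiv_fst_eq_one_of_mem_of_one_mem (one_mem _) (hd _)]
    simp
  intro h₂
  rw [hone] at h₁ h₂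
  rw [neg_neg] at h₂
  set w := NormalWord.equiv φ d y⁻¹ with hw
  have hlast : w.toList.getLast? = some (-u, 1) := h₁
  obtain ⟨l, hl⟩ := List.getLast?_eq_some_iff.1 hlast
  have hchain := w.chain
  rw [hl] at hchain
  let w' : NormalWord d :=
    { head := w.head
      toList := l
      chain := (List.isChain_append.1 hchain).1
      mem_set := fun v g hv => w.mem_set v g (by rw [hl]; exact List.mem_append_left _ hv) }
  have hy : w.prod φ = y⁻¹ := (NormalWord.equiv φ d).symm_apply_apply y⁻¹
  have hprod : w'.prod φ = (t ^ ((-u : ℤˣ) : ℤ) * y)⁻¹ := by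
    rw [mul_inv_rev, ← hy, ReducedWord.prod, ReducedWord.prod, hl]
    simp [w', mul_assoc]
  have hw' : NormalWord.equiv φ d (t ^ ((-u : ℤˣ) : ℤ) * y)⁻¹ = w' := by
    rw [← hprod]
    exact (NormalWord.equiv φ d).apply_symm_apply w'
  rw [lastLetter, hw'] at h₂
  have h3 := (List.isChain_append.1 hchain).2.2 (u, 1) h₂ (-u, 1) (by simp) (one_mem _)
  rcases Int.units_eq_one_or u with rfl | rfl <;> simp at h3

end LastLetter

/-- The generating steps of the HNN extension: elements of the base group and `t ^ ±1`. -/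
def IsStep (s : HNNExtension H A B φ) : Prop :=
  (∃ h : H, s = of h) ∨ ∃ u : ℤˣ, s = t ^ (u : ℤ)

lemma IsStep.inv {s : HNNExtension H A B φ} (h : IsStep s) : IsStep s⁻¹ := by
  rcases h with ⟨h, rfl⟩ | ⟨u, rfl⟩
  · exact .inl ⟨h⁻¹, by simp⟩
  · exact .inr ⟨-u, by simp⟩

/-- `x` lies in the left coset `zH` of the base group `H`. -/
def InCoset (z x : HNNExtension H A B φ) : Prop :=
  z⁻¹ * x ∈ (of : H →* HNNExtension H A B φ).range

lemma inCoset_iff {z x : HNNExtension H A B φ} : InCoset z x ↔ ∃ h : H, x = z * of h := by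
  refine ⟨fun ⟨h, hh⟩ => ⟨h, by rw [hh]; simp⟩, ?_⟩
  rintro ⟨h, rfl⟩
  exact ⟨h, by simp⟩

lemma inCoset_refl (z : HNNExtension H A B φ) : InCoset z z := inCoset_iff.2 ⟨1, by simp⟩

lemma inCoset_mul_of (z : HNNExtension H A B φ) (h : H) : InCoset z (z * of h) :=
  inCoset_iff.2 ⟨h, rfl⟩

lemma inCoset_congr {z z' : HNNExtension H A B φ} (h : InCoset z z') (x : HNNExtension H A B φ) :
    InCoset z' x ↔ InCoset z x := by
  unfold InCoset at *
  rw [← Subgroup.mul_mem_cancel_left _ h]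
  simp [mul_assoc]

lemma InCoset.symm {z x : HNNExtension H A B φ} (h : InCoset z x) : InCoset x z := by
  have := inv_mem h
  simpa [InCoset] using this

/-- `x` and `y` lie in the same branch at the coset `zH`, that is, they can be joined by steps
avoiding `zH`. In the Bass–Serre tree: their vertices lie in the same component of the
complement of the vertex `zH`. -/
def SameBranch (z x y : HNNExtension H A B φ) : Prop :=
  ¬ InCoset z x ∧
    Relation.ReflTransGen (fun p q => ¬ InCoset z p ∧ ¬ InCoset z q ∧ IsStep (p⁻¹ * q)) x y

namespace SameBranch

variable {z x y w : HNNExtension H A B φ}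

lemma refl (h : ¬ InCoset z x) : SameBranch z x x := ⟨h, .refl⟩

lemma left (h : SameBranch z x y) : ¬ InCoset z x := h.1

lemma right (h : SameBranch z x y) : ¬ InCoset z y := by
  obtain ⟨hx, h⟩ := h
  cases h with
  | refl => exact hx
  | tail _ h => exact h.2.1

lemma symm (h : SameBranch z x y) : SameBranch z y x := by
  refine ⟨h.right, Relation.ReflTransGen.mono ?_ _ _ h.2.swap⟩
  rintro p q ⟨hq, hp, hs⟩
  exact ⟨hp, hq, by simpa using hs.inv⟩

lemma trans (h : SameBranch z x y) (h' : SameBranch z y w) : SameBranch z x w :=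
  ⟨h.1, h.2.trans h'.2⟩

lemma of_step (hx : ¬ InCoset z x) (hy : ¬ InCoset z y) (h : IsStep (x⁻¹ * y)) :
    SameBranch z x y :=
  ⟨hx, .single ⟨hx, hy, h⟩⟩

lemma congr_center {z' : HNNExtension H A B φ} (hz : InCoset z z') :
    SameBranch z' x y ↔ SameBranch z x y := by
  simp only [SameBranch, inCoset_congr hz]

lemma lastLetter_eq (d : TransversalPair H A B) (h : SameBranch z x y) :
    lastLetter d (z⁻¹ * x) = lastLetter d (z⁻¹ * y) := by
  obtain ⟨-, h⟩ := h
  induction h with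
  | refl => rfl
  | @tail p q _ h ih =>
    rw [ih]
    obtain ⟨hp, hq, ⟨a, ha⟩ | ⟨u, hu⟩⟩ := h
    · obtain rfl : q = p * of a := by rw [← ha]; simp
      rw [← mul_assoc, lastLetter_mul_of]
    · obtain rfl : q = p * t ^ (u : ℤ) := by rw [← hu]; simp
      unfold InCoset at hp hq
      rw [← mul_assoc] at hq ⊢
      rw [lastLetter_mul_t_zpow d hp hq]

/-- All points at which a branch is entered lie in a single coset of `A` or of `B`. -/
lemma entry_coset {α β : H} {u v : ℤˣ}
    (h : SameBranch z (z * of α * t ^ (u : ℤ)) (z * of β * t ^ (v : ℤ))) :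
    α⁻¹ * β ∈ toSubgroup A B (-u) := by
  obtain ⟨d, -⟩ := exists_transversalPair_one_mem A B
  have h1 := h.lastLetter_eq d
  simp only [mul_assoc, inv_mul_cancel_left, lastLetter_of_mul_t_zpow, Option.some.injEq,
    Prod.mk.injEq, neg_inj] at h1
  obtain ⟨rfl, h1⟩ := h1
  have h2 := (d.compl (-u)).equiv_snd_eq_inv_mul α⁻¹
  have h3 := (d.compl (-u)).equiv_snd_eq_inv_mul β⁻¹
  rw [h1, h3] at h2
  have aux : ∀ a b p q : H, q⁻¹ * b = p⁻¹ * a → a * b⁻¹ = p * q⁻¹ := by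
    intro a b p q e
    obtain rfl : a = p * (q⁻¹ * b) := by rw [e]; simp
    group
  have h4 := aux _ _ _ _ h2
  rw [inv_inv] at h4
  rw [h4]
  exact mul_mem (Subtype.prop _) (inv_mem (Subtype.prop _))

/-- The two sides of an edge of the Bass–Serre tree are disjoint. -/
lemma separation {u : ℤˣ} (h₁ : SameBranch x (x * t ^ (u : ℤ)) y) :
    ¬ SameBranch (x * t ^ (u : ℤ)) x y := by
  intro h₂
  obtain ⟨d, hd⟩ := exists_transversalPair_one_mem A B
  have e₁ := h₁.lastLetter_eq d
  have e₂ := h₂.lastLetter_eq d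
  refine lastLetter_separation d hd u (x⁻¹ * y) ?_ ?_
  · rw [← e₁]; simp
  · convert e₂.symm using 2 <;> simp [mul_assoc]

end SameBranch

lemma not_inCoset_mul_t_zpow (x : HNNExtension H A B φ) (u : ℤˣ) :
    ¬ InCoset x (x * t ^ (u : ℤ)) := by
  obtain ⟨d, hd⟩ := exists_transversalPair_one_mem A B
  rw [InCoset, inv_mul_cancel_left, ← inv_mem_iff, ← equiv_toList_eq_nil_iff d]
  have := lastLetter_of_mul_t_zpow (φ := φ) d 1 u
  rw [map_one, one_mul, lastLetter] at this
  intro h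
  rw [h] at this
  simp at this

end HNNExtension

/-! ### Word metrics -/

/-- A set containing `a` but not `b` cuts an edge of some geodesic from `a` to `b`. -/
lemma SimpleGraph.Connected.exists_cut {V : Type u} {Δ : SimpleGraph V} (hΔ : Δ.Connected)
    {a b : V} {P : Set V} (ha : a ∈ P) (hb : b ∉ P) :
    ∃ k k', Δ.dist a k + Δ.dist k b = Δ.dist a b ∧ Δ.dist a k' + Δ.dist k' b = Δ.dist a b ∧
      k ∈ P ∧ k' ∉ P ∧ Δ.Adj k k' := by
  classical
  obtain ⟨w, hw⟩ := hΔ.exists_walk_length_eq_dist a b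
  obtain ⟨e, he, he₁, he₂⟩ := w.exists_boundary_dart P ha hb
  have between : ∀ k ∈ w.support, Δ.dist a k + Δ.dist k b = Δ.dist a b := by
    intro k hk
    refine le_antisymm ?_ hΔ.dist_triangle
    rw [← hw, ← w.take_spec hk, SimpleGraph.Walk.length_append]
    exact add_le_add (SimpleGraph.dist_le _) (SimpleGraph.dist_le _)
  exact ⟨e.fst, e.snd, between _ (w.dart_fst_mem_support_of_mem_darts he),
    between _ (w.dart_snd_mem_support_of_mem_darts he), he₁, he₂, e.adj⟩

section WordMetric

variable {G : Type u} [Group G] {S : Set G}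

lemma cayleyGraph_adj {x y : G} (h : (cayleyGraph S).skeleton.Adj x y) :
    ∃ s ∈ S, y = x * s ∨ y = x * s⁻¹ := by
  rw [cayleyGraph_skeleton, SimpleGraph.mulCayley_adj'] at h
  obtain ⟨-, s, hs, rfl | rfl⟩ := h
  · exact ⟨s, hs, .inl rfl⟩
  · exact ⟨s, hs, .inr (by simp)⟩

lemma cayleyGraph_dist_mul_le {s : G} (hs : s ∈ S) (x : G) :
    (cayleyGraph S).skeleton.dist x (x * s) ≤ 1 :=
  (cayleyGraph S).dist_src_tgt_le (x, ⟨s, hs⟩)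

lemma cayleyGraph_dist_mul_left (hS : Subgroup.closure S = ⊤) (g x y : G) :
    (cayleyGraph S).skeleton.dist (g * x) (g * y) = (cayleyGraph S).skeleton.dist x y := by
  have key : ∀ g x y : G, (cayleyGraph S).skeleton.dist (g * x) (g * y) ≤
      (cayleyGraph S).skeleton.dist x y := by
    intro g x y
    obtain ⟨w, hw⟩ := (cayleyGraph_connected hS).exists_walk_length_eq_dist x y
    let f : (cayleyGraph S).skeleton →g (cayleyGraph S).skeleton :=
      ⟨fun a => g * a, fun {a b} h => by
        rw [cayleyGraph_skeleton] at h ⊢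
        exact SimpleGraph.mulCayley_adj_mul_iff_right.2 h⟩
    rw [← hw, ← SimpleGraph.Walk.length_map f w]
    exact SimpleGraph.dist_le _
  refine le_antisymm (key g x y) ?_
  simpa using key g⁻¹ (g * x) (g * y)

/-- A homomorphism sending generators to elements of length at most `C` is `C`-Lipschitz. -/
lemma cayleyGraph_dist_map_le {H : Type v} [Group H] {Y : Set H} (hY : Subgroup.closure Y = ⊤)
    (hS : Subgroup.closure S = ⊤) (f : H →* G) {C : ℕ}
    (hC : ∀ y ∈ Y, (cayleyGraph S).skeleton.dist 1 (f y) ≤ C) (x : G) (a b : H) :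
    (cayleyGraph S).skeleton.dist (x * f a) (x * f b) ≤
      C * (cayleyGraph Y).skeleton.dist a b := by
  obtain ⟨w, hw⟩ := (cayleyGraph_connected hY).exists_walk_length_eq_dist a b
  rw [← hw]
  clear hw
  induction w with
  | nil => simp
  | @cons a b c hab w ih =>
    have h1 : (cayleyGraph S).skeleton.dist (x * f a) (x * f b) ≤ C := by
      obtain ⟨s, hs, rfl | rfl⟩ := cayleyGraph_adj hab
      · have := cayleyGraph_dist_mul_left hS (x * f a) 1 (f s)
        rw [map_mul, ← mul_assoc, ← mul_one (x * f a), mul_assoc _ 1, one_mul, this]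
        exact hC s hs
      · have := cayleyGraph_dist_mul_left hS (x * f (a * s⁻¹)) 1 (f s)
        rw [mul_one, mul_assoc, ← map_mul, inv_mul_cancel_right] at this
        rw [SimpleGraph.dist_comm, this]
        exact hC s hs
    have h2 := (cayleyGraph_connected hS).dist_triangle (u := x * f a) (v := x * f b)
      (w := x * f c)
    rw [SimpleGraph.Walk.length_cons, mul_add, mul_one]
    omega

end WordMetric

/-! ### Guessed geodesics in an HNN extension -/

namespace HNNExtension

variable {H : Type u} [Group H] {A B : Subgroup H} {φ : A ≃* B}

/-- `z * of α` is a point at which paths coming from `x` enter the coset `zH`. -/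
def IsEntry (z x : HNNExtension H A B φ) (α : H) : Prop :=
  z * of α = x ∨ ∃ u : ℤˣ, SameBranch z (z * of α * t ^ (u : ℤ)) x

variable {x y z : HNNExtension H A B φ} {α : H}

lemma IsEntry.of_sameBranch (h : SameBranch z x y) (hx : IsEntry z x α) : IsEntry z y α := by
  rcases hx with rfl | ⟨u, hu⟩
  · exact absurd (inCoset_mul_of z α) h.left
  · exact .inr ⟨u, hu.trans h⟩

lemma IsEntry.eq_of_inCoset (hx : IsEntry z x α) (h : InCoset z x) : z * of α = x := by
  rcases hx with rfl | ⟨u, hu⟩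
  · rfl
  · exact absurd h hu.right

lemma IsEntry.recenter (h : H) (hx : IsEntry z x α) : IsEntry (z * of h) x (h⁻¹ * α) := by
  have e : z * of h * of (h⁻¹ * α) = z * of α := by rw [map_mul]; simp [mul_assoc]
  unfold IsEntry at *
  simpa only [e, SameBranch.congr_center (inCoset_mul_of z h)] using hx

lemma exists_word (g : HNNExtension H A B φ) :
    ∃ l : List (HNNExtension H A B φ), (∀ s ∈ l, IsStep s) ∧ l.prod = g := by
  induction g using induction_on with
  | of h => exact ⟨[of h], by simpa using .inl ⟨h, rfl⟩, by simp⟩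
  | t => exact ⟨[t], by simpa using .inr ⟨1, by simp⟩, by simp⟩
  | mul x y hx hy =>
    obtain ⟨l, hl, rfl⟩ := hx
    obtain ⟨k, hk, rfl⟩ := hy
    refine ⟨l ++ k, fun s hs => ?_, by simp⟩
    rcases List.mem_append.1 hs with hs | hs
    exacts [hl s hs, hk s hs]
  | inv x hx =>
    obtain ⟨l, hl, rfl⟩ := hx
    refine ⟨(l.map (·⁻¹)).reverse, fun s hs => ?_, (List.prod_inv_reverse l).symm⟩
    simp only [List.mem_reverse, List.mem_map] at hs
    obtain ⟨s', hs', rfl⟩ := hs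
    exact (hl s' hs').inv

/-- A path ending outside the coset `zH` either avoids `zH`, or leaves it for the last time by
some step `t ^ u`. -/
lemma sameBranch_or_exists_exit (hy : ¬ InCoset z y) (l : List (HNNExtension H A B φ))
    (hl : ∀ s ∈ l, IsStep s) (hxy : x * l.prod = y) :
    SameBranch z x y ∨ ∃ (h : H) (u : ℤˣ) (l' : List (HNNExtension H A B φ)),
      SameBranch z (z * of h * t ^ (u : ℤ)) y ∧ (∀ s ∈ l', IsStep s) ∧
      z * of h * t ^ (u : ℤ) * l'.prod = y ∧ l'.length < l.length := by
  induction l generalizing x with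
  | nil =>
    left
    obtain rfl : x = y := by simpa using hxy
    exact .refl hy
  | cons s l ih =>
    have hl' : ∀ s ∈ l, IsStep s := fun s' hs' => hl s' (List.mem_cons_of_mem _ hs')
    have hs := hl s List.mem_cons_self
    have hxy' : x * s * l.prod = y := by rw [← hxy, List.prod_cons, mul_assoc]
    rcases ih hl' hxy' with hsame | ⟨h, u, l', h1, h2, h3, h4⟩
    · by_cases hx : InCoset z x
      · right
        obtain ⟨h, rfl⟩ := inCoset_iff.1 hx
        rcases hs with ⟨k, rfl⟩ | ⟨u, rfl⟩
        · exact absurd (inCoset_iff.2 ⟨h * k, by simp [mul_assoc]⟩) hsame.left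
        · exact ⟨h, u, l, hsame, hl', hxy', by simp⟩
      · exact .inl ((SameBranch.of_step hx hsame.left (by simpa using hs)).trans hsame)
    · exact .inr ⟨h, u, l', h1, h2, h3, h4.trans (by simp)⟩

lemma exists_isEntry (z x : HNNExtension H A B φ) : ∃ α, IsEntry z x α := by
  by_cases hx : InCoset z x
  · obtain ⟨α, rfl⟩ := inCoset_iff.1 hx
    exact ⟨α, .inl rfl⟩
  · obtain ⟨l, hl, hprod⟩ := exists_word (z⁻¹ * x)
    rcases sameBranch_or_exists_exit (x := z) hx l hl (by rw [hprod]; simp) with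
      h | ⟨h, u, -, hu, -⟩
    · exact absurd (inCoset_refl z) h.left
    · exact ⟨h, .inr ⟨u, hu⟩⟩

/-- The guessed geodesic from `x` to `y`. It passes through the cosets `zH` that separate `x` from
`y` (or contain one of them), and inside `zH` it consists of the geodesics, for the word metric of
the base group with respect to `Y`, from the points where `zH` is entered from `x` to the points
where it is entered from `y`. By left translation, whether `z` lies on such a geodesic is a
condition on `1 : H`. -/
def guess (Y : Set H) (x y : HNNExtension H A B φ) : Set (HNNExtension H A B φ) :=
  {z | ¬ SameBranch z x y ∧ ∃ α β, IsEntry z x α ∧ IsEntry z y β ∧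
    (cayleyGraph Y).skeleton.dist α 1 + (cayleyGraph Y).skeleton.dist 1 β =
      (cayleyGraph Y).skeleton.dist α β}

variable {Y : Set H}

lemma guess_symm (h : z ∈ guess Y x y) : z ∈ guess Y y x := by
  obtain ⟨hz, α, β, hα, hβ, hd⟩ := h
  refine ⟨fun h => hz h.symm, β, α, hβ, hα, ?_⟩
  rw [(cayleyGraph Y).skeleton.dist_comm (u := β) (v := 1),
    (cayleyGraph Y).skeleton.dist_comm (u := 1) (v := α),
    (cayleyGraph Y).skeleton.dist_comm (u := β), ← hd, add_comm]

lemma mul_of_mem_guess (hY : Subgroup.closure Y = ⊤) {h k : H} (hh : IsEntry x y h)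
    (hk : (cayleyGraph Y).skeleton.dist 1 k + (cayleyGraph Y).skeleton.dist k h =
      (cayleyGraph Y).skeleton.dist 1 h) : x * of k ∈ guess Y x y := by
  refine ⟨fun hs => hs.left (inCoset_mul_of x k).symm, k⁻¹, k⁻¹ * h, ?_, hh.recenter k, ?_⟩
  · exact .inl (by simp)
  · rw [← cayleyGraph_dist_mul_left hY k, ← cayleyGraph_dist_mul_left hY k 1,
      ← cayleyGraph_dist_mul_left hY k k⁻¹ (k⁻¹ * h)]
    simpa using hk

lemma left_mem_guess (hY : Subgroup.closure Y = ⊤) (x y : HNNExtension H A B φ) :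
    x ∈ guess Y x y := by
  obtain ⟨α, hα⟩ := exists_isEntry x y
  simpa using mul_of_mem_guess hY (k := 1) hα (by simp)

/-- After leaving `xH` for the last time, the guessed geodesic from `x` to `y` continues as the
guessed geodesic from the point reached. -/
lemma guess_subset {h : H} {u : ℤˣ} (hs : SameBranch x (x * of h * t ^ (u : ℤ)) y) :
    guess Y (x * of h * t ^ (u : ℤ)) y ⊆ guess Y x y := by
  rintro z ⟨hz, α, β, hα, hβ, hd⟩
  have hzx : ¬ InCoset z x := fun hzx => hz ((SameBranch.congr_center hzx).1 hs)
  have hzb : ¬ InCoset z (x * of h) := fun hzb =>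
    hzx ((inCoset_congr (inCoset_mul_of x h) z).1 hzb.symm).symm
  have hxb : SameBranch z (x * of h) x := .of_step hzb hzx (.inl ⟨h⁻¹, by simp⟩)
  by_cases hz' : InCoset z (x * of h * t ^ (u : ℤ))
  · refine ⟨fun hzy => ?_, α, β, .inr ⟨-u, ?_⟩, hβ, hd⟩
    · -- `y` would lie on both sides of the edge crossed by the step `t ^ u`
      exact ((SameBranch.congr_center (inCoset_mul_of x h)).2 hs).separation
        ((SameBranch.congr_center hz').2 (hxb.trans hzy))
    · rw [hα.eq_of_inCoset hz']
      simpa using hxb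
  · have hb' : SameBranch z (x * of h * t ^ (u : ℤ)) x :=
      (SameBranch.of_step hz' hzb
        (.inr ⟨-u, by rw [mul_inv_rev, inv_mul_cancel_right]; simp⟩)).trans hxb
    exact ⟨fun hzy => hz (hb'.trans hzy), α, β, hα.of_sameBranch hb', hβ, hd⟩

lemma exists_of_mem_guess_mul_of (hY : Subgroup.closure Y = ⊤) {h : H}
    (hz : z ∈ guess Y x (x * of h)) :
    ∃ k, z = x * of k ∧ (cayleyGraph Y).skeleton.dist 1 k ≤ (cayleyGraph Y).skeleton.dist 1 h := by
  obtain ⟨hz, α, β, hα, hβ, hd⟩ := hz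
  have hzx : InCoset z x := by
    by_contra hzx
    have hzy : ¬ InCoset z (x * of h) := fun hzy =>
      hzx ((inCoset_congr (inCoset_mul_of x h) z).1 hzy.symm).symm
    exact hz (.of_step hzx hzy (.inl ⟨h, by simp⟩))
  have e1 := hα.eq_of_inCoset hzx
  have e2 := hβ.eq_of_inCoset ((inCoset_congr hzx.symm _).2 (inCoset_mul_of x h))
  have e3 : α * h = β := by
    apply of_injective (φ := φ)
    rw [← e1, mul_assoc, mul_right_inj] at e2
    rw [e2, map_mul]
  refine ⟨α⁻¹, by rw [← e1]; simp, ?_⟩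
  rw [← cayleyGraph_dist_mul_left hY α, ← cayleyGraph_dist_mul_left hY α 1 h, e3, mul_one,
    mul_inv_cancel]
  omega

/-- If `A, B ⊆ Y`, all points at which a branch is entered are within distance `1`. -/
lemma dist_entry_le (hA : (A : Set H) ⊆ Y) (hB : (B : Set H) ⊆ Y) {α β : H} {u v : ℤˣ}
    (h : SameBranch z (z * of α * t ^ (u : ℤ)) (z * of β * t ^ (v : ℤ))) :
    (cayleyGraph Y).skeleton.dist α β ≤ 1 := by
  have hmem : α⁻¹ * β ∈ Y := by
    have := h.entry_coset
    unfold toSubgroup at this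
    split_ifs at this
    exacts [hA this, hB this]
  simpa using cayleyGraph_dist_mul_le hmem α

lemma exists_of_mem_guess_of_inCoset (hY : Subgroup.closure Y = ⊤) (hA : (A : Set H) ⊆ Y)
    (hB : (B : Set H) ⊆ Y) {u : ℤˣ} (hz : z ∈ guess Y x (x * t ^ (u : ℤ))) (hzx : InCoset z x) :
    ∃ k, z = x * of k ∧ (cayleyGraph Y).skeleton.dist 1 k ≤ 1 := by
  obtain ⟨-, α, β, hα, hβ, hd⟩ := hz
  have e1 := hα.eq_of_inCoset hzx
  have hαβ : (cayleyGraph Y).skeleton.dist α β ≤ 1 := by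
    rcases hβ with hβ | ⟨v, hv⟩
    · exact absurd ((inCoset_congr hzx _).2 (hβ ▸ inCoset_mul_of z β))
        (not_inCoset_mul_t_zpow x u)
    · rw [← e1] at hv
      exact dist_entry_le hA hB hv.symm
  refine ⟨α⁻¹, by rw [← e1]; simp, ?_⟩
  rw [← cayleyGraph_dist_mul_left hY α, mul_one, mul_inv_cancel]
  omega

lemma exists_of_mem_guess_mul_t_zpow (hY : Subgroup.closure Y = ⊤) (hA : (A : Set H) ⊆ Y)
    (hB : (B : Set H) ⊆ Y) {u : ℤˣ} (hz : z ∈ guess Y x (x * t ^ (u : ℤ))) :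
    ∃ k, (cayleyGraph Y).skeleton.dist 1 k ≤ 1 ∧ (z = x * of k ∨ z = x * t ^ (u : ℤ) * of k) := by
  by_cases hzx : InCoset z x
  · obtain ⟨k, hk, hk'⟩ := exists_of_mem_guess_of_inCoset hY hA hB hz hzx
    exact ⟨k, hk', .inl hk⟩
  by_cases hzy : InCoset z (x * t ^ (u : ℤ))
  · have e : x = x * t ^ (u : ℤ) * t ^ ((-u : ℤˣ) : ℤ) := by simp
    have hz' := guess_symm hz
    nth_rw 2 [e] at hz'
    obtain ⟨k, hk, hk'⟩ := exists_of_mem_guess_of_inCoset hY hA hB hz' hzy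
    exact ⟨k, hk', .inr hk⟩
  · exact absurd (.of_step hzx hzy (.inr ⟨u, by simp⟩)) hz.1

/-- Guessed triangles are thin: at each coset, the branch of the third vertex differs from the
branch of `x` or of `y`, and the claim reduces to a triangle in the base group. -/
lemma guess_thin (hY : Subgroup.closure Y = ⊤) {N : ℕ}
    (hN : (cayleyGraph Y).skeleton.HasThinIntervals N) (w : HNNExtension H A B φ)
    (hz : z ∈ guess Y x y) :
    ∃ k, (cayleyGraph Y).skeleton.dist 1 k ≤ N ∧ z * of k ∈ guess Y x w ∪ guess Y w y := by
  obtain ⟨hz, α, β, hα, hβ, hd⟩ := hz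
  by_cases hyw : SameBranch z y w
  · exact ⟨1, by simp, .inl (by
      simpa using ⟨fun h => hz (h.trans hyw.symm), α, β, hα, hβ.of_sameBranch hyw, hd⟩)⟩
  by_cases hxw : SameBranch z x w
  · exact ⟨1, by simp, .inr (by
      simpa using ⟨fun h => hz (hxw.trans h), α, β, hα.of_sameBranch hxw, hβ, hd⟩)⟩
  obtain ⟨ω, hω⟩ := exists_isEntry z w
  obtain ⟨k, hk, hk'⟩ := hN α β ω 1 hd
  have recenter : ∀ {a b}, (cayleyGraph Y).skeleton.dist a k + (cayleyGraph Y).skeleton.dist k b =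
      (cayleyGraph Y).skeleton.dist a b → (cayleyGraph Y).skeleton.dist (k⁻¹ * a) 1 +
        (cayleyGraph Y).skeleton.dist 1 (k⁻¹ * b) =
        (cayleyGraph Y).skeleton.dist (k⁻¹ * a) (k⁻¹ * b) := by
    intro a b hab
    rw [← cayleyGraph_dist_mul_left hY k, ← cayleyGraph_dist_mul_left hY k 1,
      ← cayleyGraph_dist_mul_left hY k (k⁻¹ * a) (k⁻¹ * b)]
    simpa using hab
  refine ⟨k, hk, ?_⟩
  rcases hk' with hk' | hk'
  · exact .inl ⟨fun h => hxw ((SameBranch.congr_center (inCoset_mul_of z k)).1 h),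
      _, _, hα.recenter k, hω.recenter k, recenter hk'⟩
  · exact .inr ⟨fun h => hyw ((SameBranch.congr_center (inCoset_mul_of z k)).1 h).symm,
      _, _, hω.recenter k, hβ.recenter k, recenter hk'⟩

/-- Guessed geodesics are coarsely connected, by induction on the length of a word joining the two
points: a cut separates two neighbours within the first coset, or the ends of the step by which
that coset is left for the last time, or it cuts the remaining guessed geodesic. -/
lemma guess_connected (hY : Subgroup.closure Y = ⊤) (l : List (HNNExtension H A B φ))
    (hl : ∀ s ∈ l, IsStep s) {x y : HNNExtension H A B φ} (hxy : x * l.prod = y)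
    {P : Set (HNNExtension H A B φ)} (hx : x ∈ P) (hy : y ∉ P) :
    ∃ a ∈ guess Y x y, ∃ b ∈ guess Y x y, a ∈ P ∧ b ∉ P ∧
      ((∃ c h k, (cayleyGraph Y).skeleton.dist h k ≤ 1 ∧ a = c * of h ∧ b = c * of k) ∨
        ∃ u : ℤˣ, b = a * t ^ (u : ℤ)) := by
  induction hn : l.length using Nat.strong_induction_on generalizing l x with
  | _ n ih =>
    have base : ∀ h, IsEntry x y h → x * of h ∉ P → ∃ a ∈ guess Y x y, ∃ b ∈ guess Y x y,
        a ∈ P ∧ b ∉ P ∧ ((∃ c h k, (cayleyGraph Y).skeleton.dist h k ≤ 1 ∧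
          a = c * of h ∧ b = c * of k) ∨ ∃ u : ℤˣ, b = a * t ^ (u : ℤ)) := by
      intro h hh hP
      obtain ⟨k, k', hk, hk', hkP, hkP', hadj⟩ := (cayleyGraph_connected hY).exists_cut
        (a := 1) (b := h) (P := {k | x * of k ∈ P}) (by simpa using hx) hP
      exact ⟨_, mul_of_mem_guess hY hh hk, _, mul_of_mem_guess hY hh hk', hkP, hkP',
        .inl ⟨x, k, k', (SimpleGraph.dist_eq_one_iff_adj.2 hadj).le, rfl, rfl⟩⟩
    by_cases hxy' : InCoset x y
    · obtain ⟨h, rfl⟩ := inCoset_iff.1 hxy'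
      exact base h (.inl rfl) hy
    rcases sameBranch_or_exists_exit (x := x) hxy' l hl hxy with hs | ⟨h, u, l', hs, hl', hp, hlt⟩
    · exact absurd (inCoset_refl x) hs.left
    have hh : IsEntry x y h := .inr ⟨u, hs⟩
    by_cases hb : x * of h ∈ P
    · by_cases hb' : x * of h * t ^ (u : ℤ) ∈ P
      · obtain ⟨a, ha, b, hb, hab⟩ := ih _ (hn ▸ hlt) l' hl' hp hb' rfl
        exact ⟨a, guess_subset hs ha, b, guess_subset hs hb, hab⟩
      · exact ⟨_, mul_of_mem_guess hY hh (by simp), _, guess_subset hs (left_mem_guess hY _ _),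
          hb, hb', .inr ⟨u, rfl⟩⟩
    · exact base h hh hb

/-- Let `Y ⊇ A ∪ B` generate `H` with hyperbolic Cayley graph. Then the Cayley graph of the HNN
extension is hyperbolic for every generating set consisting of `t` and of elements of `Y`, as long
as the elements of `Y` have bounded length with respect to it. -/
theorem isHyperbolicSpace_cayleyGraph (hY : Subgroup.closure Y = ⊤) (hA : (A : Set H) ⊆ Y)
    (hB : (B : Set H) ⊆ Y) {N : ℕ} (hN : (cayleyGraph Y).skeleton.HasThinIntervals N)
    {S : Set (HNNExtension H A B φ)} (hS : Subgroup.closure S = ⊤)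
    (hSY : ∀ s ∈ S, (∃ y ∈ Y, s = of y) ∨ s = t) (ht : t ∈ S) {C : ℕ}
    (hC : ∀ y ∈ Y, (cayleyGraph S).skeleton.dist 1 (of y) ≤ C) :
    IsHyperbolicSpace (OrientedGraph.Realization (cayleyGraph_connected hS)) := by
  have lip := cayleyGraph_dist_map_le hY hS of hC
  have hconn := cayleyGraph_connected hS
  have dist_of : ∀ (x : HNNExtension H A B φ) (k : H) (n : ℕ),
      (cayleyGraph Y).skeleton.dist 1 k ≤ n →
        (cayleyGraph S).skeleton.dist (x * of k) x ≤ C * n := by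
    intro x k n hk
    have := lip x 1 k
    rw [map_one, mul_one, SimpleGraph.dist_comm] at this
    exact this.trans (Nat.mul_le_mul_left _ hk)
  have dist_t : ∀ (x : HNNExtension H A B φ) (u : ℤˣ),
      (cayleyGraph S).skeleton.dist x (x * t ^ (u : ℤ)) ≤ 1 := by
    intro x u
    rcases Int.units_eq_one_or u with rfl | rfl
    · simpa using cayleyGraph_dist_mul_le ht x
    · rw [SimpleGraph.dist_comm]
      have := cayleyGraph_dist_mul_le ht (x * t⁻¹)
      rw [inv_mul_cancel_right] at this
      simpa using this
  have small_of : ∀ (x : HNNExtension H A B φ) (h : H), (cayleyGraph Y).skeleton.dist 1 h ≤ 1 →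
      ∀ z ∈ guess Y x (x * of h), (cayleyGraph S).skeleton.dist z x ≤ C := by
    intro x h hh z hz
    obtain ⟨k, rfl, hk⟩ := exists_of_mem_guess_mul_of hY hz
    simpa using dist_of x k 1 (hk.trans hh)
  have small_t : ∀ (x : HNNExtension H A B φ) (u : ℤˣ), ∀ z ∈ guess Y x (x * t ^ (u : ℤ)),
      (cayleyGraph S).skeleton.dist z x ≤ C + 1 := by
    intro x u z hz
    obtain ⟨k, hk, rfl | rfl⟩ := exists_of_mem_guess_mul_t_zpow hY hA hB hz
    · have := dist_of x k 1 hk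
      omega
    · have h1 := dist_of (x * t ^ (u : ℤ)) k 1 hk
      have h2 := dist_t x u
      rw [SimpleGraph.dist_comm] at h2
      have := hconn.dist_triangle (u := x * t ^ (u : ℤ) * of k) (v := x * t ^ (u : ℤ)) (w := x)
      omega
  refine OrientedGraph.isHyperbolicSpace_of_vertex_guess hconn (guess Y) (C * N + C + 1)
    (left_mem_guess hY) (fun x y => guess_symm (left_mem_guess hY y x)) ?_ ?_ ?_ ?_
  · intro x y hxy z hz
    obtain ⟨s, hs, rfl | rfl⟩ := cayleyGraph_adj hxy
    · rcases hSY s hs with ⟨a, ha, rfl⟩ | rfl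
      · have := small_of x a (by simpa using cayleyGraph_dist_mul_le ha 1) z hz
        omega
      · have := small_t x 1 z (by simpa using hz)
        omega
    · rcases hSY s hs with ⟨a, ha, rfl⟩ | rfl
      · have := small_of x a⁻¹ (by
          rw [SimpleGraph.dist_comm]
          simpa using cayleyGraph_dist_mul_le ha a⁻¹) z (by simpa using hz)
        omega
      · have := small_t x (-1) z (by simpa using hz)
        omega
  · intro x z hz
    have := small_of x 1 (by simp) z (by simpa using hz)
    omega
  · intro x y w z hz
    obtain ⟨k, hk, hk'⟩ := guess_thin hY hN w hz
    have := dist_of z k N hk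
    rw [SimpleGraph.dist_comm] at this
    exact ⟨_, hk', by omega⟩
  · intro x y P hx hy
    obtain ⟨l, hl, hprod⟩ := exists_word (x⁻¹ * y)
    obtain ⟨a, ha, b, hb, haP, hbP, hab⟩ :=
      guess_connected hY l hl (x := x) (y := y) (by rw [hprod]; simp) hx hy
    refine ⟨a, ha, b, hb, haP, hbP, ?_⟩
    rcases hab with ⟨c, h, k, hhk, rfl, rfl⟩ | ⟨u, rfl⟩
    · have h1 := lip c h k
      have h2 := Nat.mul_le_mul_left C hhk
      omega
    · have := dist_t a u
      omega

lemma closure_eq_top {S : Set (HNNExtension H A B φ)} (ht : t ∈ Subgroup.closure S)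
    (hY : Subgroup.closure Y = ⊤) (hof : ∀ y ∈ Y, of y ∈ Subgroup.closure S) :
    Subgroup.closure S = ⊤ := by
  have hH : ∀ h : H, of h ∈ Subgroup.closure S := by
    intro h
    have : (⊤ : Subgroup H) ≤ (Subgroup.closure S).comap of := by
      rw [← hY, Subgroup.closure_le]
      exact hof
    exact this (Subgroup.mem_top h)
  refine eq_top_iff.2 fun g _ => ?_
  induction g using induction_on with
  | of h => exact hH h
  | t => exact ht
  | mul x y hx hy => exact mul_mem (hx trivial) (hy trivial)
  | inv x hx => exact inv_mem (hx trivial)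

/-! ### Weak relative hyperbolicity -/

/-- With respect to all of `H`, the base group has bounded Cayley graph. -/
theorem isWeaklyHyperbolicRelativeTo_base :
    IsWeaklyHyperbolicRelativeTo ({(of : H →* HNNExtension H A B φ).range} :
      Set (Subgroup (HNNExtension H A B φ))) := by
  set S := relativeAlphabet ({(of : H →* HNNExtension H A B φ).range} :
      Set (Subgroup (HNNExtension H A B φ))) {t} with hSdef
  have hmem : ∀ s, s ∈ S ↔ s = t ∨ ∃ h, of h = s := by
    intro s
    simp [hSdef, relativeAlphabet]
  have ht : (t : HNNExtension H A B φ) ∈ S := (hmem _).2 (.inl rfl)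
  have hof : ∀ h : H, (of h : HNNExtension H A B φ) ∈ S := fun h => (hmem _).2 (.inr ⟨h, rfl⟩)
  have hY : Subgroup.closure (Set.univ : Set H) = ⊤ := Subgroup.closure_univ
  have hS : Subgroup.closure S = ⊤ :=
    closure_eq_top (Subgroup.subset_closure ht) hY fun y _ => Subgroup.subset_closure (hof y)
  refine ⟨{t}, hS, Set.finite_singleton _, ?_⟩
  refine isHyperbolicSpace_cayleyGraph hY (Set.subset_univ _) (Set.subset_univ _) (N := 1) ?_ hS
    ?_ ht (C := 1) ?_
  · intro x y w z _
    exact ⟨x, by simpa using cayleyGraph_dist_mul_le (Set.mem_univ (z⁻¹ * x)) z, .inl (by simp)⟩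
  · intro s hs
    rcases (hmem s).1 hs with rfl | ⟨h, rfl⟩
    exacts [.inr rfl, .inl ⟨h, trivial, rfl⟩]
  · intro y _
    simpa using cayleyGraph_dist_mul_le (hof y) 1

/-- Elements `φ a = t * a * t⁻¹` of `B` have length at most `3` with respect to `A` and `t`. -/
theorem isWeaklyHyperbolicRelativeTo_associated
    (h : IsWeaklyHyperbolicRelativeTo ({A, B} : Set (Subgroup H))) :
    IsWeaklyHyperbolicRelativeTo ({A.map (of : H →* HNNExtension H A B φ)} :
      Set (Subgroup (HNNExtension H A B φ))) := by
  obtain ⟨X, hX, hfin, hhyp⟩ := h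
  obtain ⟨N, hN⟩ := OrientedGraph.hasThinIntervals_of_isHyperbolicSpace hhyp
  have hYmem : ∀ y, y ∈ relativeAlphabet {A, B} X ↔ y ∈ X ∨ y ∈ A ∨ y ∈ B := by
    intro y
    simp [relativeAlphabet]
  set X' : Set (HNNExtension H A B φ) := insert t (of '' X) with hX'
  set S := relativeAlphabet ({A.map (of : H →* HNNExtension H A B φ)} :
      Set (Subgroup (HNNExtension H A B φ))) X' with hSdef
  have hmem : ∀ s, s ∈ S ↔ (s = t ∨ ∃ x ∈ X, of x = s) ∨ ∃ a ∈ A, of a = s := by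
    intro s
    simp [hSdef, hX', relativeAlphabet]
  have ht : (t : HNNExtension H A B φ) ∈ S := (hmem _).2 (.inl (.inl rfl))
  have hXS : ∀ x ∈ X, (of x : HNNExtension H A B φ) ∈ S :=
    fun x hx => (hmem _).2 (.inl (.inr ⟨x, hx, rfl⟩))
  have hAS : ∀ a ∈ A, (of a : HNNExtension H A B φ) ∈ S :=
    fun a ha => (hmem _).2 (.inr ⟨a, ha, rfl⟩)
  have hBS : ∀ b ∈ B, ∃ a ∈ A, (of b : HNNExtension H A B φ) = t * of a * t⁻¹ := by
    intro b hb
    refine ⟨φ.symm ⟨b, hb⟩, Subtype.prop _, ?_⟩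
    rw [← equiv_eq_conj]
    simp
  have hS : Subgroup.closure S = ⊤ := by
    refine closure_eq_top (Subgroup.subset_closure ht) hX fun y hy => ?_
    rcases (hYmem y).1 hy with hy | hy | hy
    · exact Subgroup.subset_closure (hXS y hy)
    · exact Subgroup.subset_closure (hAS y hy)
    · obtain ⟨a, ha, e⟩ := hBS y hy
      rw [e]
      exact mul_mem (mul_mem (Subgroup.subset_closure ht) (Subgroup.subset_closure (hAS a ha)))
        (inv_mem (Subgroup.subset_closure ht))
  refine ⟨X', hS, (hfin.image _).insert _, ?_⟩
  refine isHyperbolicSpace_cayleyGraph hX (fun a ha => (hYmem a).2 (.inr (.inl ha)))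
    (fun b hb => (hYmem b).2 (.inr (.inr hb))) hN hS ?_ ht (C := 3) ?_
  · intro s hs
    rcases (hmem s).1 hs with (rfl | ⟨x, hx, rfl⟩) | ⟨a, ha, rfl⟩
    exacts [.inr rfl, .inl ⟨x, (hYmem x).2 (.inl hx), rfl⟩,
      .inl ⟨a, (hYmem a).2 (.inr (.inl ha)), rfl⟩]
  · intro y hy
    rcases (hYmem y).1 hy with hy | hy | hy
    · have := cayleyGraph_dist_mul_le (hXS y hy) 1
      rw [one_mul] at this
      omega
    · have := cayleyGraph_dist_mul_le (hAS y hy) 1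
      rw [one_mul] at this
      omega
    · obtain ⟨a, ha, e⟩ := hBS y hy
      have h1 := cayleyGraph_dist_mul_le ht (1 : HNNExtension H A B φ)
      have h2 := cayleyGraph_dist_mul_le (hAS a ha) (1 * t)
      have h3 := cayleyGraph_dist_mul_le ht (1 * t * of a * t⁻¹)
      rw [inv_mul_cancel_right, SimpleGraph.dist_comm] at h3
      have hconn := cayleyGraph_connected hS
      have h4 := hconn.dist_triangle (u := 1) (v := 1 * t) (w := 1 * t * of a)
      have h5 := hconn.dist_triangle (u := 1) (v := 1 * t * of a) (w := 1 * t * of a * t⁻¹)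
      rw [e, ← one_mul t]
      simp only [mul_assoc, one_mul] at *
      omega

end HNNExtension

end

theorem theorem1p1 {H : Type*} [Group H] (A B : Subgroup H) (φ : A ≃* B) :
    IsWeaklyHyperbolicRelativeTo
        ({(HNNExtension.of : H →* HNNExtension H A B φ).range} :
          Set (Subgroup (HNNExtension H A B φ))) ∧
      (IsWeaklyHyperbolicRelativeTo ({A, B} : Set (Subgroup H)) →
        IsWeaklyHyperbolicRelativeTo
          ({A.map (HNNExtension.of : H →* HNNExtension H A B φ)} :
            Set (Subgroup (HNNExtension H A B φ)))) :=
  ⟨HNNExtension.isWeaklyHyperbolicRelativeTo_base,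
    HNNExtension.isWeaklyHyperbolicRelativeTo_associated⟩
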